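/- Let $d\in\mathbb N$, let $E$ be a finite set and $\Omega=E^{\mathbb Z^d\times\mathbb Z}$ with the product $\sigma$-algebra; write $\eta_t(x)$ for the value of $\eta\in\Omega$ at $(x,t)$, and let $(\theta_{x,t}\eta)_s(y)=\eta_{s+t}(y+x)$. Let $\mathbb P$ be a probability measure on $\Omega$ that is invariant under all shifts $\theta_{x,t}$, $(x,t)\in\mathbb Z^d\times\mathbb Z$, and ergodic in the time direction, i.e. every event $B$ with $\theta_{o,1}^{-1}B=B$ has $\mathbb P(B)\in\{0,1\}$. Let $\alpha:\Omega\times\mathbb Z^d\to[0,1]$ satisfy $\sum_{z}\alpha(\eta,z)=1$ for all $\eta$, and let $R\in\mathbb N$ be such that $\alpha(\eta,\cdot)=\alpha(\sigma,\cdot)$ whenever $\eta=\sigma$ on $[-R,R]^d\times\{0\}$ and such that every $z$ in the jump range $\mathcal R=\{z\in\mathbb Z^d:\sup_{\eta}\alpha(\eta,z)>0\}$ satisfies $\|z\|_1\le R$. For $\eta\in\Omega$ let $P_\eta$ be the law on $(\mathbb Z^d)^{\mathbb Z_{\ge0}}$ of the Markov chain $(X_t)_{t\ge0}$ with $X_0=o$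 and $$P_\eta(X_{t+1}=y+z\mid X_t=y)=\alpha(\theta_{y,t}\eta,z),$$ and let $P_{\mathbb P}$ be the joint law of $(\eta,X)$, $P_{\mathbb P}(B\times A)=\int_B P_\eta(A)\,d\mathbb P(\eta)$. For $k\ge1$ let $\Gamma_k$ be the set of all $(\gamma_{-k},\dots,\gamma_0)$ in $\mathbb Z^d$ with $\gamma_0=o$ and $\gamma_i-\gamma_{i-1}\in\mathcal R$ for $-k<i\le0$. For $\gamma\in\Gamma_k$ and $\sigma\in\Omega$ let $$A_{-k}^{-1}(\gamma,\sigma)=\{\eta\in\Omega:\ \eta_i(\gamma_i+y)=\sigma_i(y)\ \text{ for all } -k\le i\le-1,\ y\in[-R,R]^d\},$$ and let $\mathcal A_{-\infty}$ be the collection of all events $A_{-k}^{-1}(\gamma,\sigma)$ with $k\ge1$, $\gamma\in\Gamma_k$, $\sigma\in\Omega$ that have positive $\mathbb P$-probability. For $l\in\mathbb N$ let $\mathcal C(l)=\{(x,t)\in\mathbb Z^d\times\mathbb Z:\ t\ge0,\ t\ge l,\ \|x\|_1\le(R+1)t\}$, and let $\mathcal F_{\mathcal C(l)}$ be the $\sigma$-algebra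 generated by the coordinates in $\mathcal C(l)$. Assume the mixing condition $$\lim_{l\to\infty}\ \sup_{B\in\mathcal F_{\mathcal C(l)}}\ \sup_{A\in\mathcal A_{-\infty}}\bigl|\mathbb P(B\mid A)-\mathbb P(B)\bigr|=0,$$ and that the walk is elliptic in the time direction, i.e. $\alpha(\eta,o)>0$ for all $\eta\in\Omega$. Then there exists a deterministic $v\in\mathbb R^d$ such that $$\lim_{t\to\infty}\tfrac1t X_t=v\qquad P_{\mathbb P}\text{-almost surely.}$$ -/

import Mathlib

open MeasureTheory ProbabilityTheory Filter Topology

open scoped ENNReal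

/-- The lattice `ℤ^d`; a space-time point is a pair `(x, t) : Site d × ℤ`. -/
abbrev Site (d : ℕ) : Type := Fin d → ℤ

/-- The `ℓ¹`-norm on `ℤ^d`. -/
def Site.norm1 {d : ℕ} (x : Site d) : ℤ := ∑ i, |x i|

/-- The box `[-R,R]^d`. -/
def box (d R : ℕ) : Set (Site d) := {y | ∀ i, |y i| ≤ (R : ℤ)}

/-- The space `Ω = E^{ℤ^{d+1}}` of environments, with `ℤ^{d+1} = ℤ^d × ℤ`; it carries the product
`σ`-algebra. -/
abbrev Env (E : Type*) (d : ℕ) : Type _ := Site d × ℤ → E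

/-- The shift `θ_{x,t}`: `(θ_{x,t} η)_s(y) = η_{s+t}(y+x)`. -/
def Env.shift {E : Type*} {d : ℕ} (x : Site d) (t : ℤ) (η : Env E d) : Env E d :=
  fun p => η (p.1 + x, p.2 + t)

lemma Env.measurable_shift {E : Type*} [MeasurableSpace E] {d : ℕ} (x : Site d) (t : ℤ) :
    Measurable (Env.shift (E := E) x t) := by
  unfold Env.shift; fun_prop

/-- `P` is preserved by all space-time translations. -/
def TranslationInvariant {E : Type*} [MeasurableSpace E] {d : ℕ} (P : Measure (Env E d)) : Prop :=
  ∀ (x : Site d) (t : ℤ), MeasurePreserving (Env.shift (E := E) x t) P P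

/-- `P` is ergodic in the time direction: ergodic for the shift `θ_{o,1}`. -/
def ErgodicInTime {E : Type*} [MeasurableSpace E] {d : ℕ} (P : Measure (Env E d)) : Prop :=
  Ergodic (Env.shift (E := E) (0 : Site d) 1) P

/-- Transition probabilities `α(η, ·)` of a random walk in the environment `η`, depending only on
the values of `η` on `[-R,R]^d × {0}`, with all jumps of `ℓ¹`-length at most `R`. -/
structure JumpRule (E : Type*) (d R : ℕ) where
  /-- `α(η, ·)`, a probability vector on `ℤ^d` for every `η`. -/
  prob : Env E d → PMF (Site d)
  local_dep : ∀ η σ : Env E d,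
    (∀ y ∈ box d R, η (y, 0) = σ (y, 0)) → prob η = prob σ
  range_le : ∀ (η : Env E d) (z : Site d), 0 < prob η z → z.norm1 ≤ (R : ℤ)

namespace JumpRule

variable {E : Type*} {d R : ℕ}

/-- The jump range `{z : sup_η α(η, z) > 0}`. -/
def jumpRange (α : JumpRule E d R) : Set (Site d) := {z | 0 < ⨆ η : Env E d, α.prob η z}

/-- Ellipticity in the time direction: `α(η, o) > 0` for all `η`. -/
def EllipticInTime (α : JumpRule E d R) : Prop := ∀ η : Env E d, 0 < α.prob η 0

/-- Given the trajectory `h` of the walk up to time `n`, the law of its position at time `n + 1`: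
from `y = h n` the walk jumps to `y + z` with probability `α(θ_{y,n} η, z)`. -/
noncomputable def step (α : JumpRule E d R) (η : Env E d) (n : ℕ) :
    Kernel ((i : Finset.Iic n) → Site d) (Site d) :=
  Kernel.ofFunOfCountable fun h =>
    ((α.prob (Env.shift (h ⟨n, Finset.mem_Iic.2 le_rfl⟩) n η)).map
      fun z => h ⟨n, Finset.mem_Iic.2 le_rfl⟩ + z).toMeasure

instance (α : JumpRule E d R) (η : Env E d) (n : ℕ) : IsMarkovKernel (α.step η n) :=
  ⟨fun h => by
    change IsProbabilityMeasure (PMF.toMeasure _)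
    infer_instance⟩

/-- The quenched law `P_η` on trajectories `ℕ → ℤ^d`: the walk started from the origin at time `0`
with the one-step transitions `step`. -/
noncomputable def quenchedLaw (α : JumpRule E d R) (η : Env E d) : Measure (ℕ → Site d) :=
  Kernel.traj (X := fun _ => Site d) (α.step η) 0 fun _ => 0

instance (α : JumpRule E d R) (η : Env E d) : IsProbabilityMeasure (α.quenchedLaw η) := by
  unfold quenchedLaw; infer_instance

lemma step_apply_singleton (α : JumpRule E d R) (η : Env E d) (n : ℕ)
    (h : (i : Finset.Iic n) → Site d) (y : Site d) :
    α.step η n h {y} = α.prob (Env.shift (h ⟨n, Finset.mem_Iic.2 le_rfl⟩) n η)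
      (y - h ⟨n, Finset.mem_Iic.2 le_rfl⟩) := by
  change PMF.toMeasure _ _ = _
  rw [PMF.toMeasure_apply_singleton _ _ (measurableSet_singleton _), PMF.map_apply,
    tsum_eq_single (y - h ⟨n, Finset.mem_Iic.2 le_rfl⟩)]
  · simp
  · intro b hb
    rw [if_neg]
    rintro rfl
    simp at hb

/-- The path probabilities of the quenched law: `P_η(X_0 = o) = 1` and
`P_η(X_{t+1} = y + z | X_0, …, X_{t-1}, X_t = y) = α(θ_{y,t} η, z)`. -/
lemma quenchedLaw_cylinder (α : JumpRule E d R) (η : Env E d) (n : ℕ) (x : ℕ → Site d) :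
    α.quenchedLaw η {X | ∀ i ≤ n, X i = x i} =
      if x 0 = 0 then
        ∏ i ∈ Finset.range n, α.prob (Env.shift (x i) i η) (x (i + 1) - x i) else 0 := by
  have hcyl : ∀ m : ℕ, {X : ℕ → Site d | ∀ i ≤ m, X i = x i} =
      Preorder.frestrictLe (π := fun _ => Site d) m ⁻¹'
        {Preorder.frestrictLe (π := fun _ => Site d) m x} := by
    intro m
    ext X
    simp only [Set.mem_ofPred_eq, Set.mem_preimage, Set.mem_singleton_iff, funext_iff,
      Preorder.frestrictLe_apply, Subtype.forall, Finset.mem_Iic]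
  have hpast : ∀ (m : ℕ) (h : (i : Finset.Iic m) → Site d),
      (Kernel.traj (X := fun _ => Site d) (α.step η) m h).map
        (Preorder.frestrictLe (π := fun _ => Site d) m) = Measure.dirac h := by
    intro m h
    rw [Kernel.traj_map_frestrictLe_apply, Kernel.partialTraj_self, Kernel.id_apply]
  induction n with
  | zero =>
    rw [hcyl, quenchedLaw, ← Measure.map_apply (by fun_prop) (measurableSet_singleton _), hpast,
      Measure.dirac_apply' _ (measurableSet_singleton _)]
    have : ((fun _ => 0 : (i : Finset.Iic 0) → Site d) ∈
        ({Preorder.frestrictLe (π := fun _ => Site d) 0 x} : Set _)) ↔ x 0 = 0 := by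
      simp [funext_iff, eq_comm]
    by_cases hx : x 0 = 0
    · simp [Set.indicator, this, hx]
    · simp [Set.indicator, this, hx]
  | succ n ih =>
    have hmeas : MeasurableSet {X : ℕ → Site d | ∀ i ≤ n + 1, X i = x i} := by
      rw [hcyl]
      exact (by fun_prop : Measurable (Preorder.frestrictLe (π := fun _ => Site d) (n + 1)))
        (measurableSet_singleton _)
    set r := Preorder.frestrictLe (π := fun _ => Site d) n x with hr
    have hsplit : {X : ℕ → Site d | ∀ i ≤ n + 1, X i = x i} =
        Preorder.frestrictLe (π := fun _ => Site d) n ⁻¹' {r} ∩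
          (fun X : ℕ → Site d => X (n + 1)) ⁻¹' {x (n + 1)} := by
      rw [hr, ← hcyl]
      ext X
      simp only [Set.mem_ofPred_eq, Set.mem_inter_iff, Set.mem_preimage, Set.mem_singleton_iff]
      exact ⟨fun h => ⟨fun i hi => h i (by omega), h _ le_rfl⟩, fun h i hi => by
        rcases Nat.lt_or_ge n i with h1 | h1
        · obtain rfl : i = n + 1 := by omega
          exact h.2
        · exact h.1 i h1⟩
    have hkey : ∀ h : (i : Finset.Iic n) → Site d,
        Kernel.traj (X := fun _ => Site d) (α.step η) n h {X | ∀ i ≤ n + 1, X i = x i} =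
          ({r} : Set _).indicator
            (fun _ => α.prob (Env.shift (x n) n η) (x (n + 1) - x n)) h := by
      intro h
      have hr1 : Kernel.traj (X := fun _ => Site d) (α.step η) n h
          (Preorder.frestrictLe (π := fun _ => Site d) n ⁻¹' {r}) =
            ({r} : Set _).indicator 1 h := by
        rw [← Measure.map_apply (by fun_prop) (measurableSet_singleton _), hpast,
          Measure.dirac_apply' _ (measurableSet_singleton _)]
      rw [hsplit]
      by_cases hh : h = r
      · have hone : Kernel.traj (X := fun _ => Site d) (α.step η) n h
            (Preorder.frestrictLe (π := fun _ => Site d) n ⁻¹' {r})ᶜ = 0 := by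
          rw [prob_compl_eq_zero_iff ((by fun_prop :
            Measurable (Preorder.frestrictLe (π := fun _ => Site d) n))
              (measurableSet_singleton _)), hr1]
          simp [hh]
        rw [Set.inter_comm, measure_inter_conull' (by
          refine measure_mono_null ?_ hone
          exact fun a ha => ha.2),
          ← Measure.map_apply (by fun_prop) (measurableSet_singleton _),
          ← Kernel.map_apply _ (by fun_prop), Kernel.map_traj_succ_self, step_apply_singleton]
        simp [hh, hr]
      · rw [Set.indicator_of_notMem (by simpa using hh)]
        refine measure_mono_null Set.inter_subset_left ?_
        rw [hr1, Set.indicator_of_notMem (by simpa using hh)]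
    rw [quenchedLaw, ← Kernel.traj_comp_partialTraj (Nat.zero_le n),
      Kernel.comp_apply' _ _ _ hmeas]
    simp_rw [hkey]
    rw [lintegral_indicator (measurableSet_singleton _), setLIntegral_const,
      ← Kernel.traj_map_frestrictLe_apply, Measure.map_apply (by fun_prop)
      (measurableSet_singleton _), hr, ← hcyl]
    rw [quenchedLaw] at ih
    rw [ih, Finset.prod_range_succ]
    split_ifs
    · rw [mul_comm]
    · simp

lemma finite_box (d R : ℕ) : (box d R).Finite := by
  refine (Set.Finite.pi' (t := fun _ : Fin d => Set.Icc (-(R : ℤ)) R)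
    fun _ => Set.finite_Icc _ _).subset fun y hy i => ?_
  exact abs_le.1 (hy i)

variable [Finite E] [MeasurableSpace E] [MeasurableSingletonClass E]

lemma measurable_prob (α : JumpRule E d R) (z : Site d) :
    Measurable fun η : Env E d => α.prob η z := by
  have : Finite (box d R) := finite_box d R
  let r : Env E d → box d R → E := fun η y => η (y.1, 0)
  have hr : Measurable r := by fun_prop
  intro S _
  have : (fun η : Env E d => α.prob η z) ⁻¹' S =
      r ⁻¹' (r '' ((fun η : Env E d => α.prob η z) ⁻¹' S)) := by
    refine Set.Subset.antisymm (Set.subset_preimage_image _ _) ?_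
    rintro η ⟨σ, hσ, hση⟩
    have : α.prob σ = α.prob η :=
      α.local_dep σ η fun y hy => congrFun hση ⟨y, hy⟩
    simpa [Set.mem_preimage, this] using hσ
  rw [this]
  exact hr (Set.toFinite _).measurableSet

lemma measurable_quenchedLaw (α : JumpRule E d R) : Measurable α.quenchedLaw := by
  have hcoord : ∀ (n : ℕ) (h : (i : Finset.Iic n) → Site d),
      Measurable fun η => α.quenchedLaw η
        (Preorder.frestrictLe (π := fun _ => Site d) n ⁻¹' {h}) := by
    intro n h
    let x : ℕ → Site d := fun i => if hi : i ≤ n then h ⟨i, Finset.mem_Iic.2 hi⟩ else 0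
    have hx : Preorder.frestrictLe (π := fun _ => Site d) n ⁻¹' {h} =
        {X : ℕ → Site d | ∀ i ≤ n, X i = x i} := by
      ext X
      simp only [Set.mem_ofPred_eq, Set.mem_preimage, Set.mem_singleton_iff, funext_iff,
        Preorder.frestrictLe_apply, Subtype.forall, Finset.mem_Iic]
      refine forall_congr' fun i => forall_congr' fun hi => ?_
      simp [x, hi]
    simp_rw [hx, quenchedLaw_cylinder]
    split_ifs
    · exact Finset.measurable_prod _ fun i _ =>
        (α.measurable_prob _).comp (Env.measurable_shift _ _)
    · exact measurable_const
  refine Measurable.measure_of_isPiSystem_of_isProbabilityMeasure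
    generateFrom_measurableCylinders.symm isPiSystem_measurableCylinders fun t ht => ?_
  obtain ⟨n, S, -, rfl⟩ : ∃ (n : ℕ) (S : Set ((i : Finset.Iic n) → Site d)),
      MeasurableSet S ∧ t = cylinder (Finset.Iic n) S := by
    simpa [measurableCylinders_nat] using ht
  have hS : ∀ η, α.quenchedLaw η (cylinder (Finset.Iic n) S) = ∑' h : S, α.quenchedLaw η
      (Preorder.frestrictLe (π := fun _ => Site d) n ⁻¹' {h.1}) := by
    intro η
    rw [tsum_measure_preimage_singleton S.to_countable fun y _ =>
      (by fun_prop : Measurable (Preorder.frestrictLe (π := fun _ => Site d) n))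
        (measurableSet_singleton _)]
    rfl
  simp_rw [hS]
  exact Measurable.tsum fun h => hcoord n h.1

/-- The quenched laws `η ↦ P_η` as a Markov kernel. -/
noncomputable def quenchedKernel (α : JumpRule E d R) : Kernel (Env E d) (ℕ → Site d) where
  toFun := α.quenchedLaw
  measurable' := α.measurable_quenchedLaw

instance (α : JumpRule E d R) : IsMarkovKernel α.quenchedKernel :=
  ⟨fun η => inferInstanceAs (IsProbabilityMeasure (α.quenchedLaw η))⟩

/-- The joint law `P_P` of the environment and the walk on `Ω × (ℤ^d)^ℕ`:
`P_P(B × A) = ∫_B P_η(A) dP(η)`. -/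
noncomputable def jointLaw (α : JumpRule E d R) (P : Measure (Env E d)) :
    Measure (Env E d × (ℕ → Site d)) :=
  P ⊗ₘ α.quenchedKernel

lemma jointLaw_prod (α : JumpRule E d R) (P : Measure (Env E d)) [IsProbabilityMeasure P]
    {B : Set (Env E d)} {A : Set (ℕ → Site d)} (hB : MeasurableSet B) (hA : MeasurableSet A) :
    α.jointLaw P (B ×ˢ A) = ∫⁻ η in B, α.quenchedLaw η A ∂P :=
  Measure.compProd_apply_prod hB hA

end JumpRule

/-- The forward cone `{(x, t) : t ≥ 0, ‖x‖₁ ≤ (R + 1) t}`. -/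
def cone (d R : ℕ) : Set (Site d × ℤ) := {p | 0 ≤ p.2 ∧ p.1.norm1 ≤ ((R : ℤ) + 1) * p.2}

/-- The part of the forward cone at times `≥ l`. -/
def coneFrom (d R l : ℕ) : Set (Site d × ℤ) := cone d R ∩ {p | (l : ℤ) ≤ p.2}

namespace JumpRule

variable {E : Type*} {d R : ℕ}

/-- The backward trajectories `(γ_{-k}, …, γ_0)` of length `k` from the origin: `γ j` stands for
`γ_{-j}`, so the jump from time `-(j+1)` to time `-j` is `γ j - γ (j + 1)`. (Values `γ j` with
`k < j` are irrelevant.) -/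
def backwardPaths (α : JumpRule E d R) (k : ℕ) : Set (ℕ → Site d) :=
  {γ | γ 0 = 0 ∧ ∀ j < k, γ j - γ (j + 1) ∈ α.jumpRange}

/-- The event that at each of the times `-k, …, -1` the environment in the `R`-box around the path
`γ` is given by the time slice of `σ` at that time:
`η_{-j}(γ_{-j} + y) = σ_{-j}(y)` for `1 ≤ j ≤ k`, `y ∈ [-R,R]^d`. -/
def observation (R : ℕ) (k : ℕ) (γ : ℕ → Site d) (σ : Env E d) : Set (Env E d) :=
  {η | ∀ j : ℕ, 1 ≤ j → j ≤ k → ∀ y ∈ box d R,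
    Env.shift (γ j) (-(j : ℤ)) η (y, 0) = σ (y, -(j : ℤ))}

variable [MeasurableSpace E]

/-- The family `𝒜_{-∞}` of all observations of positive probability along backward paths of
arbitrary length `k ≥ 1`. -/
def pastObservations (α : JumpRule E d R) (P : Measure (Env E d)) : Set (Set (Env E d)) :=
  {A | ∃ k : ℕ, 1 ≤ k ∧ ∃ γ ∈ α.backwardPaths k, ∃ σ : Env E d,
    A = observation R k γ σ ∧ 0 < P A}

/-- The mixing condition
`lim_{l → ∞} sup_{B ∈ 𝓕_{𝒞(l)}} sup_{A ∈ 𝒜_{-∞}} |P(B | A) - P(B)| = 0`. -/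
def ConeMixing (α : JumpRule E d R) (P : Measure (Env E d)) : Prop :=
  Tendsto (fun l : ℕ =>
    ⨆ B ∈ {B : Set (Env E d) |
        MeasurableSet[cylinderEvents (X := fun _ : Site d × ℤ => E) (coneFrom d R l)] B},
      ⨆ A ∈ α.pastObservations P, ENNReal.ofReal |(cond P A).real B - P.real B|)
    atTop (𝓝 0)

end JumpRule

/-! Fix a coordinate `i` and let m_n(η) be the quenched mean of that coordinate at time n (`mean`).
It is enough to find, for every δ > 0, an n such that the mean displacement over the next n steps,
given the trajectory so far, is within nδ of the constant E m_n. Cutting time into blocks of length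
n, exponential moments and Borel–Cantelli (`ae_eventually_sum_lt`) then keep X_t/t eventually close
to E m_n / n, and letting δ → 0 forces convergence to a deterministic limit.

The estimate is carried by the relation `Dominated`: |∫_A h dP| ≤ ∫_A g dP for every observation A
of the past along a backward path. It survives averaging over one step of the walk
(`Dominated.map_avg`), because an observation, refined by the slice the walker now sees and shifted
along the jump, is again an observation. It also survives following a prescribed trajectory
(`Dominated.pathWeight_mul`), which turns it into a statement on the walk given its past.

Mixing needs a time gap between past and future, and ellipticity creates one: with weight ε^l the
walk rests for l steps whatever the environment is. After such a rest its future depends only on the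
cone, and mixing makes m_n deviate from E m_n by at most nc, where c is small for large l. On the
remaining weight 1 - ε^l only the bound already known for n is available. As l steps change means by
O(l), bounds e_n on the deviation can be chosen with e_{n+l} ≥ (1 - ε^l) e_n + ε^l nc + 2Rl, and e_n
= 2Rl/ε^l + nc qualifies (`dominated_mean_sub`). The first term does not grow with n, so e_n/n
becomes small. -/

/-! ### Norms and boxes in the lattice. -/

namespace Site

variable {d R : ℕ}

lemma abs_apply_le_norm1 (x : Site d) (i : Fin d) : |x i| ≤ x.norm1 :=
  Finset.single_le_sum (f := fun i => |x i|) (fun _ _ => abs_nonneg _) (Finset.mem_univ i)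

lemma norm1_add_le (x y : Site d) : (x + y).norm1 ≤ x.norm1 + y.norm1 := by
  unfold norm1
  rw [← Finset.sum_add_distrib]
  exact Finset.sum_le_sum fun i _ => abs_add_le _ _

lemma norm1_le_of_mem_box {y : Site d} (hy : y ∈ box d R) : y.norm1 ≤ d * R := by
  unfold norm1
  calc ∑ i, |y i| ≤ ∑ _i : Fin d, (R : ℤ) := Finset.sum_le_sum fun i _ => hy i
    _ = d * R := by simp

lemma finite_norm1_le (d R : ℕ) : {z : Site d | z.norm1 ≤ R}.Finite :=
  (JumpRule.finite_box d R).subset fun z hz i => (abs_apply_le_norm1 z i).trans hz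

end Site

/-- The possible jumps: the `ℓ¹`-ball of radius `R`. -/
noncomputable def jumps (d R : ℕ) : Finset (Site d) := (Site.finite_norm1_le d R).toFinset

lemma mem_jumps {d R : ℕ} {z : Site d} : z ∈ jumps d R ↔ z.norm1 ≤ R := by
  simp [jumps]

lemma zero_mem_jumps (d R : ℕ) : (0 : Site d) ∈ jumps d R := by
  simp [mem_jumps, Site.norm1]

/-! ### Local functions and bounded measurable functions of the environment. -/

namespace Env

variable {E : Type*} {d R : ℕ}

lemma shift_shift (x y : Site d) (s t : ℤ) (η : Env E d) :
    shift x s (shift y t η) = shift (y + x) (t + s) η := by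
  funext p
  simp [shift, add_comm, add_left_comm]

@[simp] lemma shift_zero (η : Env E d) : shift 0 0 η = η := by
  funext p
  simp [shift]

/-- The restriction of the environment to `[-R,R]^d × {0}`. -/
def slice (R : ℕ) (η : Env E d) : box d R → E := fun y => η (y.1, 0)

/-- A function of the environment which depends only on `[-R,R]^d × {0}`. -/
def IsLocal (R : ℕ) {F : Type*} (f : Env E d → F) : Prop :=
  ∀ η σ : Env E d, (∀ y ∈ box d R, η (y, 0) = σ (y, 0)) → f η = f σ

lemma IsLocal.exists_eq_comp_slice {F : Type*} [Nonempty F] {f : Env E d → F}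
    (hf : IsLocal R f) : ∃ g : (box d R → E) → F, f = g ∘ slice R := by
  refine (Function.factorsThrough_iff f).1 fun η σ h => hf η σ fun y hy => ?_
  exact congrFun h ⟨y, hy⟩

lemma measurable_slice [MeasurableSpace E] : Measurable (slice (E := E) (d := d) R) := by
  unfold slice; fun_prop

lemma abs_integral_le_of_abs_le {Ω : Type*} [MeasurableSpace Ω] {P : Measure Ω}
    [IsProbabilityMeasure P] {f : Ω → ℝ} {b : ℝ} (hf : ∀ η, |f η| ≤ b) : |∫ η, f η ∂P| ≤ b := by
  simpa using norm_integral_le_of_norm_le_const (μ := P) (f := f) (C := b) (ae_of_all _ hf)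

/-- Bounded measurable functions of the environment. -/
def BddMeasurable [MeasurableSpace E] (f : Env E d → ℝ) : Prop :=
  Measurable f ∧ ∃ b, ∀ η, |f η| ≤ b

section

variable [MeasurableSpace E]

lemma BddMeasurable.integrable {f : Env E d → ℝ} (hf : BddMeasurable f)
    (P : Measure (Env E d)) [IsFiniteMeasure P] : Integrable f P := by
  obtain ⟨hm, b, hb⟩ := hf
  exact Integrable.of_bound hm.aestronglyMeasurable b (ae_of_all _ hb)

lemma BddMeasurable.const (c : ℝ) : BddMeasurable fun _ : Env E d => c :=
  ⟨measurable_const, |c|, fun _ => le_rfl⟩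

lemma BddMeasurable.add {f g : Env E d → ℝ} (hf : BddMeasurable f) (hg : BddMeasurable g) :
    BddMeasurable fun η => f η + g η := by
  obtain ⟨hm, b, hb⟩ := hf
  obtain ⟨hm', b', hb'⟩ := hg
  exact ⟨hm.add hm', b + b', fun η => (abs_add_le _ _).trans (add_le_add (hb η) (hb' η))⟩

lemma BddMeasurable.mul {f g : Env E d → ℝ} (hf : BddMeasurable f) (hg : BddMeasurable g) :
    BddMeasurable fun η => f η * g η := by
  obtain ⟨hm, b, hb⟩ := hf
  obtain ⟨hm', b', hb'⟩ := hg
  refine ⟨hm.mul hm', b * b', fun η => ?_⟩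
  rw [abs_mul]
  exact mul_le_mul (hb η) (hb' η) (abs_nonneg _) ((abs_nonneg _).trans (hb η))

lemma BddMeasurable.sub {f g : Env E d → ℝ} (hf : BddMeasurable f) (hg : BddMeasurable g) :
    BddMeasurable fun η => f η - g η := by
  simpa [sub_eq_add_neg] using hf.add ((BddMeasurable.const (-1)).mul hg)

lemma BddMeasurable.sum {ι : Type*} (s : Finset ι) {f : ι → Env E d → ℝ}
    (hf : ∀ i ∈ s, BddMeasurable (f i)) : BddMeasurable fun η => ∑ i ∈ s, f i η := by
  classical
  induction s using Finset.induction_on with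
  | empty => simpa using BddMeasurable.const 0
  | insert i s hi ih =>
    simp only [Finset.sum_insert hi]
    exact (hf i (by simp)).add (ih fun j hj => hf j (by simp [hj]))

lemma BddMeasurable.comp_shift {f : Env E d → ℝ} (hf : BddMeasurable f) (x : Site d) (t : ℤ) :
    BddMeasurable fun η => f (shift x t η) :=
  ⟨hf.1.comp (measurable_shift x t), hf.2.imp fun _ hb _ => hb _⟩

lemma IsLocal.bddMeasurable [Finite E] [MeasurableSingletonClass E] {f : Env E d → ℝ}
    (hf : IsLocal R f) : BddMeasurable f := by
  have : Finite (box d R) := JumpRule.finite_box d R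
  obtain ⟨g, rfl⟩ := hf.exists_eq_comp_slice
  refine ⟨(measurable_of_countable g).comp measurable_slice, ?_⟩
  obtain ⟨b, hb⟩ := (Set.finite_range fun s => |g s|).bddAbove
  exact ⟨b, fun η => hb ⟨_, rfl⟩⟩

end

end Env

/-! ### Observations of the past, one-step averaging and domination. -/

namespace JumpRule

open Env

variable {E : Type*} {d R : ℕ}

/-- The averaging operator `f ↦ ∑_z β(η, z) f(θ_{z,1} η)`. -/
noncomputable def avg (R : ℕ) (β : Env E d → Site d → ℝ) (f : Env E d → ℝ) : Env E d → ℝ :=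
  fun η => ∑ z ∈ jumps d R, β η z * f (shift z 1 η)

/-- Nonnegative local weights carried by the jump range of `α`. -/
structure IsLocalWeight (α : JumpRule E d R) (β : Env E d → Site d → ℝ) : Prop where
  nonneg : ∀ η z, 0 ≤ β η z
  isLocal : IsLocal R β
  mem_jumpRange : ∀ η z, β η z ≠ 0 → z ∈ α.jumpRange

lemma IsLocalWeight.isLocal_apply {α : JumpRule E d R} {β : Env E d → Site d → ℝ}
    (hβ : α.IsLocalWeight β) (z : Site d) : IsLocal R fun η => β η z :=
  fun η σ h => congrFun (hβ.isLocal η σ h) z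

lemma measurableSet_observation [Finite E] [MeasurableSpace E] [MeasurableSingletonClass E]
    (k : ℕ) (γ : ℕ → Site d) (σ : Env E d) : MeasurableSet (observation R k γ σ) := by
  have : observation R k γ σ = ⋂ j : ℕ, ⋂ _ : 1 ≤ j, ⋂ _ : j ≤ k, ⋂ y ∈ box d R,
      (fun η : Env E d => η (y + γ j, -(j : ℤ))) ⁻¹' {σ (y, -(j : ℤ))} := by
    ext η
    simp [observation, shift]
  rw [this]
  refine .iInter fun j => .iInter fun _ => .iInter fun _ =>
    .biInter (finite_box d R).countable fun y _ => ?_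
  exact measurable_pi_apply _ (measurableSet_singleton _)

/-- Length 0 is allowed in `Dominated`, though not in `pastObservations`, so that the unconditioned
integral is covered as well. -/
lemma observation_zero (γ : ℕ → Site d) (σ : Env E d) : observation R 0 γ σ = Set.univ := by
  ext η
  simp only [observation, Set.mem_ofPred_eq, Set.mem_univ, iff_true]
  intro j h1 h2
  omega

/-- The trajectory `γ` prolonged by a jump `z` and recentred. -/
def consPath (z : Site d) (γ : ℕ → Site d) : ℕ → Site d
  | 0 => 0
  | j + 1 => γ j - z

lemma consPath_mem {α : JumpRule E d R} {k : ℕ} {γ : ℕ → Site d} (hγ : γ ∈ α.backwardPaths k)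
    {z : Site d} (hz : z ∈ α.jumpRange) : consPath z γ ∈ α.backwardPaths (k + 1) := by
  refine ⟨rfl, fun j hj => ?_⟩
  cases j with
  | zero => simpa [consPath, hγ.1] using hz
  | succ j => simpa [consPath] using hγ.2 j (by omega)

open Classical in
/-- The record `σ` prolonged by a new slice `s`. -/
noncomputable def consRecord (s : box d R → E) (σ : Env E d) : Env E d := fun p =>
  if h : p.2 = -1 ∧ p.1 ∈ box d R then s ⟨p.1, h.2⟩ else σ (p.1, p.2 + 1)

/-- Seen from the walker after the jump `z`, everything observed before lies one time unit further
back, and the slice it has just used to jump becomes the observation at time -1. -/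
lemma shift_mem_observation_cons {k : ℕ} {γ : ℕ → Site d} (hγ : γ 0 = 0) (z : Site d)
    (s : box d R → E) (σ η : Env E d) :
    shift z 1 η ∈ observation R (k + 1) (consPath z γ) (consRecord s σ) ↔
      η ∈ observation R k γ σ ∧ slice R η = s := by
  simp only [observation, Set.mem_ofPred_eq]
  have h0 : (∀ y ∈ box d R, shift (consPath z γ 1) (-((0 + 1 : ℕ) : ℤ)) (shift z 1 η) (y, 0) =
      consRecord s σ (y, -((0 + 1 : ℕ) : ℤ))) ↔ slice R η = s := by
    rw [funext_iff]
    simp only [Subtype.forall]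
    refine forall₂_congr fun y hy => ?_
    simp [shift, consPath, consRecord, slice, hγ, hy]
  have h1 : ∀ j : ℕ, 1 ≤ j → ((∀ y ∈ box d R,
      shift (consPath z γ (j + 1)) (-((j + 1 : ℕ) : ℤ)) (shift z 1 η) (y, 0) =
      consRecord s σ (y, -((j + 1 : ℕ) : ℤ))) ↔
      ∀ y ∈ box d R, shift (γ j) (-(j : ℤ)) η (y, 0) = σ (y, -(j : ℤ))) := by
    intro j hj
    refine forall₂_congr fun y hy => ?_
    have hne : ¬ (-((j + 1 : ℕ) : ℤ) = -1) := by push_cast; omega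
    simp only [consRecord, hne, false_and, dite_false]
    rw [shift_shift]
    simp [shift, consPath]
  constructor
  · intro h
    exact ⟨fun j hj hjk => (h1 j hj).1 (h (j + 1) (by omega) (by omega)),
      h0.1 (h 1 le_rfl (by omega))⟩
  · rintro ⟨h, hs⟩ j hj hjk
    obtain ⟨j, rfl⟩ : ∃ i, j = i + 1 := ⟨j - 1, by omega⟩
    rcases Nat.eq_zero_or_pos j with rfl | hj0
    · exact h0.2 hs
    · exact (h1 j hj0).2 (h j hj0 (by omega))

variable [MeasurableSpace E]

/-- On every observation of the past, the integral of `h` is bounded by that of `g`. -/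
def Dominated (α : JumpRule E d R) (P : Measure (Env E d)) (h g : Env E d → ℝ) : Prop :=
  ∀ k : ℕ, ∀ γ ∈ α.backwardPaths k, ∀ σ : Env E d,
    |∫ η in observation R k γ σ, h η ∂P| ≤ ∫ η in observation R k γ σ, g η ∂P

section

variable {α : JumpRule E d R} {P : Measure (Env E d)}

lemma Dominated.const_mul {h g : Env E d → ℝ} (H : α.Dominated P h g) {c : ℝ} (hc : 0 ≤ c) :
    α.Dominated P (fun η => c * h η) (fun η => c * g η) := by
  intro k γ hγ σ
  rw [integral_const_mul, integral_const_mul, abs_mul, abs_of_nonneg hc]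
  exact mul_le_mul_of_nonneg_left (H k γ hγ σ) hc

variable [IsProbabilityMeasure P]

lemma Dominated.add {h h' g g' : Env E d → ℝ} (H : α.Dominated P h g) (H' : α.Dominated P h' g')
    (hh : BddMeasurable h) (hh' : BddMeasurable h') (hg : BddMeasurable g)
    (hg' : BddMeasurable g') :
    α.Dominated P (fun η => h η + h' η) (fun η => g η + g' η) := by
  intro k γ hγ σ
  rw [integral_add (hh.integrable _) (hh'.integrable _),
    integral_add (hg.integrable _) (hg'.integrable _)]
  exact (abs_add_le _ _).trans (add_le_add (H k γ hγ σ) (H' k γ hγ σ))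

lemma Dominated.of_abs_le {h g : Env E d → ℝ} (H : ∀ η, |h η| ≤ g η) (hh : BddMeasurable h)
    (hg : BddMeasurable g) : α.Dominated P h g := by
  intro k γ hγ σ
  exact (abs_integral_le_integral_abs).trans
    (integral_mono (hh.integrable _).abs (hg.integrable _) H)

lemma Dominated.mono {h g g' : Env E d → ℝ} (H : α.Dominated P h g) (hg : BddMeasurable g)
    (hg' : BddMeasurable g') (hgg' : ∀ η, g η ≤ g' η) : α.Dominated P h g' :=
  fun k γ hγ σ => (H k γ hγ σ).trans
    (integral_mono (hg.integrable _) (hg'.integrable _) hgg')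

end

variable [Finite E] [MeasurableSingletonClass E]

section

variable {α : JumpRule E d R} {β : Env E d → Site d → ℝ}

lemma IsLocalWeight.bddMeasurable (hβ : α.IsLocalWeight β) (z : Site d) :
    BddMeasurable fun η => β η z := (hβ.isLocal_apply z).bddMeasurable

lemma IsLocalWeight.bddMeasurable_avg (hβ : α.IsLocalWeight β) {f : Env E d → ℝ}
    (hf : BddMeasurable f) : BddMeasurable (avg R β f) :=
  BddMeasurable.sum _ fun z _ => (hβ.bddMeasurable z).mul (hf.comp_shift z 1)

variable {P : Measure (Env E d)} [IsProbabilityMeasure P]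

/-- Decomposition of the integral of `avg β f` over an observation according to the next slice. -/
lemma IsLocalWeight.exists_setIntegral_avg_eq (hβ : α.IsLocalWeight β)
    (hinv : TranslationInvariant P) :
    ∃ b : (box d R → E) → Site d → ℝ, (∀ s z, 0 ≤ b s z) ∧ (∀ s z, b s z ≠ 0 → z ∈ α.jumpRange) ∧
      ∀ (_ : Fintype (box d R → E)) (f : Env E d → ℝ), BddMeasurable f →
        ∀ (k : ℕ) (γ : ℕ → Site d), γ 0 = 0 → ∀ σ : Env E d,
          ∫ η in observation R k γ σ, avg R β f η ∂P = ∑ s, ∑ z ∈ jumps d R, b s z *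
            ∫ η in observation R (k + 1) (consPath z γ) (consRecord s σ), f η ∂P := by
  classical
  obtain ⟨g, hg⟩ := hβ.isLocal.exists_eq_comp_slice
  have hg' : ∀ η, β η = g (slice R η) := fun η => congrFun hg η
  -- The factor `g` of the weight is controlled only on actual slices; the value 0 elsewhere keeps
  -- the sign and support conditions.
  refine ⟨fun s => if s ∈ Set.range (slice (E := E) (d := d) R) then g s else 0, ?_, ?_, ?_⟩
  · intro s z
    dsimp only
    split_ifs with h
    · obtain ⟨η, rfl⟩ := h
      rw [← hg']
      exact hβ.nonneg η z
    · exact le_rfl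
  · intro s z
    dsimp only
    split_ifs with h
    · obtain ⟨η, rfl⟩ := h
      rw [← hg']
      exact hβ.mem_jumpRange η z
    · simp
  · intro _ f hf k γ hγ σ
    have hmeas : ∀ s, MeasurableSet (observation R k γ σ ∩ slice R ⁻¹' {s}) := fun s => by
      have : Finite (box d R) := finite_box d R
      exact (measurableSet_observation k γ σ).inter (measurable_slice (measurableSet_singleton s))
    have hunion : observation R k γ σ = ⋃ s, observation R k γ σ ∩ slice R ⁻¹' {s} := by
      ext η
      simp
    conv_lhs => rw [hunion]
    rw [integral_iUnion_fintype hmeas]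
    · refine Finset.sum_congr rfl fun s _ => ?_
      -- The same set is a preimage under each shift, with a prolonged path depending on `z`; this
      -- lets every jump be handled by translation invariance.
      have hpre : ∀ z, observation R k γ σ ∩ slice R ⁻¹' {s} =
          shift z 1 ⁻¹' observation R (k + 1) (consPath z γ) (consRecord s σ) := fun z => by
        ext η
        exact (shift_mem_observation_cons hγ z s σ η).symm
      have hE : ∫ η in observation R k γ σ ∩ slice R ⁻¹' {s}, avg R β f η ∂P =
          ∫ η in observation R k γ σ ∩ slice R ⁻¹' {s}, ∑ z ∈ jumps d R,
            (if s ∈ Set.range (slice (E := E) (d := d) R) then g s else 0) z *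
              f (shift z 1 η) ∂P := by
        refine setIntegral_congr_fun (hmeas s) fun η hη => ?_
        have hs : slice R η = s := hη.2
        simp only [avg, hg' η, hs]
        rw [if_pos ⟨η, hs⟩]
      rw [hE, integral_finsetSum _ fun z _ => ((hf.comp_shift z 1).integrable _).const_mul _]
      refine Finset.sum_congr rfl fun z _ => ?_
      rw [integral_const_mul, hpre z]
      congr 1
      have hmp := hinv z 1
      conv_rhs => rw [← hmp.map_eq]
      rw [setIntegral_map (measurableSet_observation _ _ _) hf.1.aestronglyMeasurable
        hmp.measurable.aemeasurable]
    · intro s s' hss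
      refine Set.disjoint_left.2 fun η h h' => hss ?_
      exact h.2.symm.trans h'.2
    · exact fun s => ((hβ.bddMeasurable_avg hf).integrable P).integrableOn

/-- On an observation refined by the next slice the weights are constants, so the integral is a
nonnegative combination of integrals over observations one step longer. Weights vanish off the jump
range, so only admissible backward paths occur. -/
lemma Dominated.map_avg {h g : Env E d → ℝ} (H : α.Dominated P h g) (hinv : TranslationInvariant P)
    (hβ : α.IsLocalWeight β) (hh : BddMeasurable h) (hg : BddMeasurable g) :
    α.Dominated P (avg R β h) (avg R β g) := by
  have : Finite (box d R) := finite_box d R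
  have := Fintype.ofFinite (box d R → E)
  intro k γ hγ σ
  obtain ⟨b, hb0, hbr, hb⟩ := hβ.exists_setIntegral_avg_eq hinv
  rw [hb this h hh k γ hγ.1 σ, hb this g hg k γ hγ.1 σ]
  refine (Finset.abs_sum_le_sum_abs _ _).trans (Finset.sum_le_sum fun s _ =>
    (Finset.abs_sum_le_sum_abs _ _).trans (Finset.sum_le_sum fun z _ => ?_))
  rw [abs_mul, abs_of_nonneg (hb0 s z)]
  by_cases hz : b s z = 0
  · simp [hz]
  · exact mul_le_mul_of_nonneg_left (H _ _ (consPath_mem hγ (hbr s z hz)) _) (hb0 s z)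

end

end JumpRule

/-! ### Quenched means, resting, and the recursive error bound. -/

namespace JumpRule

open Env

variable {E : Type*} {d R : ℕ} (α : JumpRule E d R)

/-- The transition probabilities as real numbers. -/
noncomputable def transProb (η : Env E d) (z : Site d) : ℝ := (α.prob η z).toReal

lemma transProb_nonneg (η : Env E d) (z : Site d) : 0 ≤ α.transProb η z := ENNReal.toReal_nonneg

lemma transProb_eq_zero {η : Env E d} {z : Site d} (hz : z ∉ jumps d R) : α.transProb η z = 0 := by
  by_contra h
  refine hz (mem_jumps.2 (α.range_le η z (pos_iff_ne_zero.2 fun h0 => h ?_)))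
  simp [transProb, h0]

lemma sum_transProb (η : Env E d) : ∑ z ∈ jumps d R, α.transProb η z = 1 := by
  have h := (α.prob η).tsum_coe
  rw [tsum_eq_sum (s := jumps d R)] at h
  · unfold transProb
    rw [← ENNReal.toReal_sum fun z _ => (α.prob η).apply_ne_top z, h, ENNReal.toReal_one]
  · intro z hz
    by_contra h0
    exact hz (mem_jumps.2 (α.range_le η z (pos_iff_ne_zero.2 h0)))

lemma isLocalWeight_transProb : α.IsLocalWeight α.transProb where
  nonneg := α.transProb_nonneg
  isLocal η σ h := by
    unfold transProb
    rw [α.local_dep η σ h]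
  mem_jumpRange η z h := by
    have : 0 < α.prob η z := pos_iff_ne_zero.2 fun h0 => h (by simp [transProb, h0])
    exact this.trans_le (le_iSup (fun η => α.prob η z) η)

lemma avg_transProb_const (c : ℝ) : avg R α.transProb (fun _ => c) = fun _ => c := by
  funext η
  simp only [avg]
  rw [← Finset.sum_mul, sum_transProb, one_mul]

lemma abs_avg_transProb_le {f : Env E d → ℝ} {b : ℝ} (hf : ∀ η, |f η| ≤ b) (η : Env E d) :
    |avg R α.transProb f η| ≤ b := by
  calc |avg R α.transProb f η| ≤ ∑ z ∈ jumps d R, |α.transProb η z * f (shift z 1 η)| :=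
        Finset.abs_sum_le_sum_abs _ _
    _ ≤ ∑ z ∈ jumps d R, α.transProb η z * b := Finset.sum_le_sum fun z _ => by
        rw [abs_mul, abs_of_nonneg (α.transProb_nonneg η z)]
        exact mul_le_mul_of_nonneg_left (hf _) (α.transProb_nonneg η z)
    _ = b := by rw [← Finset.sum_mul, sum_transProb, one_mul]

lemma avg_sub (β : Env E d → Site d → ℝ) (f g : Env E d → ℝ) :
    avg R β (fun η => f η - g η) = fun η => avg R β f η - avg R β g η := by
  funext η
  simp [avg, mul_sub]

/-- The quenched mean of the `i`-th coordinate of the walk at time `n`. -/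
noncomputable def mean (i : Fin d) : ℕ → Env E d → ℝ
  | 0 => fun _ => 0
  | n + 1 => fun η => ∑ z ∈ jumps d R, α.transProb η z * ((z i : ℝ) + mean i n (shift z 1 η))

variable (i : Fin d)

lemma mean_succ (n : ℕ) (η : Env E d) :
    α.mean i (n + 1) η = α.mean i 1 η + avg R α.transProb (α.mean i n) η := by
  simp [mean, avg, mul_add, Finset.sum_add_distrib]

lemma abs_mean_one_le (η : Env E d) : |α.mean i 1 η| ≤ R := by
  calc |α.mean i 1 η| ≤ ∑ z ∈ jumps d R, |α.transProb η z * ((z i : ℝ) + 0)| :=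
        Finset.abs_sum_le_sum_abs _ _
    _ ≤ ∑ z ∈ jumps d R, α.transProb η z * R := Finset.sum_le_sum fun z hz => by
        rw [abs_mul, abs_of_nonneg (α.transProb_nonneg η z), add_zero]
        refine mul_le_mul_of_nonneg_left ?_ (α.transProb_nonneg η z)
        exact_mod_cast (Site.abs_apply_le_norm1 z i).trans (mem_jumps.1 hz)
    _ = R := by rw [← Finset.sum_mul, sum_transProb, one_mul]

lemma abs_mean_succ_sub_le (n : ℕ) (η : Env E d) :
    |α.mean i (n + 1) η - α.mean i n η| ≤ R := by
  induction n generalizing η with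
  | zero => simpa [mean] using α.abs_mean_one_le i η
  | succ n ih =>
    rw [mean_succ α i (n + 1), mean_succ α i n, add_sub_add_left_eq_sub]
    simpa [avg_sub] using α.abs_avg_transProb_le ih η

lemma abs_mean_add_sub_le (n l : ℕ) (η : Env E d) :
    |α.mean i (n + l) η - α.mean i n η| ≤ R * l := by
  induction l with
  | zero => simp
  | succ l ih =>
    have h := α.abs_mean_succ_sub_le i (n + l) η
    push_cast
    rw [abs_le] at *
    constructor <;> rw [← add_assoc n l 1] <;> linarith [h.1, h.2, ih.1, ih.2]

lemma abs_mean_le (n : ℕ) (η : Env E d) : |α.mean i n η| ≤ R * n := by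
  simpa [mean] using α.abs_mean_add_sub_le i 0 n η

/-- By the Markov property the difference is the mean displacement during the first `l` steps. -/
lemma abs_mean_add_sub_avg_le (n l : ℕ) (η : Env E d) :
    |α.mean i (n + l) η - (avg R α.transProb)^[l] (α.mean i n) η| ≤ R * l := by
  induction l generalizing η with
  | zero => simp
  | succ l ih =>
    have h := α.abs_avg_transProb_le ih η
    have h1 := α.abs_mean_one_le i η
    rw [avg_sub] at h
    rw [Function.iterate_succ_apply', ← add_assoc, mean_succ]
    push_cast
    rw [abs_le] at *
    constructor <;> linarith [h.1, h.2, h1.1, h1.2]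

lemma iterate_avg_transProb_sub (f : Env E d → ℝ) (c : ℝ) (l : ℕ) :
    (avg R α.transProb)^[l] (fun η => f η - c) =
      fun η => (avg R α.transProb)^[l] f η - c := by
  induction l with
  | zero => rfl
  | succ l ih =>
    rw [Function.iterate_succ_apply', ih, avg_sub, avg_transProb_const, Function.iterate_succ_apply']

/-- The uniform lower bound for the probability to stay put. -/
lemma EllipticInTime.exists_pos_le [Finite E] {α : JumpRule E d R} (h : α.EllipticInTime) :
    ∃ ε : ℝ, 0 < ε ∧ ε ≤ 1 ∧ ∀ η, ε ≤ α.transProb η 0 := by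
  have : Finite (box d R) := finite_box d R
  obtain ⟨g, hg⟩ := (α.isLocalWeight_transProb.isLocal_apply 0).exists_eq_comp_slice
  -- By locality and finiteness of `E` only finitely many values occur, so the infimum is attained
  -- and positive.
  have hfin : (Set.range fun η => α.transProb η 0).Finite := by
    rw [hg]
    exact (Set.finite_range g).subset (Set.range_comp_subset_range _ _)
  rcases isEmpty_or_nonempty (Env E d) with hE | ⟨⟨η₀⟩⟩
  · exact ⟨1, one_pos, le_rfl, fun η => hE.elim η⟩
  · obtain ⟨_, ⟨η, rfl⟩, hη⟩ := Set.exists_min_image _ id hfin ⟨_, η₀, rfl⟩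
    refine ⟨α.transProb η 0, ENNReal.toReal_pos (h η).ne' (PMF.apply_ne_top _ _), ?_,
      fun σ => hη _ ⟨σ, rfl⟩⟩
    exact (Finset.single_le_sum (fun z _ => α.transProb_nonneg η z) (zero_mem_jumps d R)).trans_eq
      (α.sum_transProb η)

/-- The weight `ε` on the jump `o`. -/
noncomputable def stayWeight (ε : ℝ) : Env E d → Site d → ℝ := fun _ => Pi.single 0 ε

lemma avg_stayWeight (ε : ℝ) (f : Env E d → ℝ) :
    avg R (stayWeight ε) f = fun η => ε * f (shift 0 1 η) := by
  funext η
  simp only [avg, stayWeight]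
  rw [Finset.sum_eq_single_of_mem 0 (zero_mem_jumps d R)]
  · simp
  · intro z _ hz
    simp [hz]

variable {α} in
lemma EllipticInTime.isLocalWeight_stayWeight (h : α.EllipticInTime) {ε : ℝ} (hε : 0 ≤ ε) :
    α.IsLocalWeight (stayWeight ε) where
  nonneg _ z := by
    by_cases hz : z = 0
    · simp [stayWeight, hz, hε]
    · simp [stayWeight, hz]
  isLocal _ _ _ := rfl
  mem_jumpRange η z hz := by
    obtain rfl : z = 0 := by
      by_contra h0
      simp [stayWeight, h0] at hz
    exact (h η).trans_le (le_iSup (fun η => α.prob η 0) η)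

/-- Splitting off the rest with constant weight `ε` leaves a nonnegative local weight, to which
`Dominated.map_avg` still applies. -/
lemma isLocalWeight_transProb_sub {ε : ℝ} (hε : 0 ≤ ε) (h : ∀ η, ε ≤ α.transProb η 0) :
    α.IsLocalWeight fun η z => α.transProb η z - stayWeight ε η z where
  nonneg η z := by
    by_cases hz : z = 0
    · subst hz
      simpa [stayWeight] using h η
    · simpa [stayWeight, hz] using α.transProb_nonneg η z
  isLocal η σ hησ := by
    dsimp only
    rw [α.isLocalWeight_transProb.isLocal η σ hησ]
    rfl
  mem_jumpRange η z hz := by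
    refine α.isLocalWeight_transProb.mem_jumpRange η z fun h0 => hz ?_
    by_cases hz0 : z = 0
    · subst hz0
      have := h η
      simp only [h0, stayWeight, Pi.single_eq_same] at this ⊢
      linarith
    · simp [h0, stayWeight, hz0]

lemma avg_transProb_sub (ε : ℝ) (f : Env E d → ℝ) :
    avg R (fun η z => α.transProb η z - stayWeight ε η z) f =
      fun η => avg R α.transProb f η - ε * f (shift 0 1 η) := by
  funext η
  have := congrFun (avg_stayWeight (R := R) ε f) η
  rw [← this]
  simp [avg, sub_mul]

variable [Finite E] [MeasurableSpace E] [MeasurableSingletonClass E]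

lemma bddMeasurable_avg_transProb {f : Env E d → ℝ} (hf : BddMeasurable f) :
    BddMeasurable (avg R α.transProb f) := α.isLocalWeight_transProb.bddMeasurable_avg hf

lemma bddMeasurable_iterate_avg {f : Env E d → ℝ} (hf : BddMeasurable f) (l : ℕ) :
    BddMeasurable ((avg R α.transProb)^[l] f) := by
  induction l with
  | zero => exact hf
  | succ l ih =>
    rw [Function.iterate_succ_apply']
    exact α.bddMeasurable_avg_transProb ih

lemma bddMeasurable_mean (n : ℕ) : BddMeasurable (α.mean i n) := by
  induction n with
  | zero => exact BddMeasurable.const 0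
  | succ n ih =>
    exact BddMeasurable.sum _ fun z _ => (α.isLocalWeight_transProb.bddMeasurable z).mul
      ((BddMeasurable.const _).add (ih.comp_shift z 1))

variable {α} {P : Measure (Env E d)} [IsProbabilityMeasure P]

lemma Dominated.iterate_avg {h : Env E d → ℝ} {a : ℝ} (H : α.Dominated P h fun _ => a)
    (hinv : TranslationInvariant P) (hh : BddMeasurable h) (l : ℕ) :
    α.Dominated P ((avg R α.transProb)^[l] h) fun _ => a := by
  induction l with
  | zero => exact H
  | succ l ih =>
    rw [Function.iterate_succ_apply', ← α.avg_transProb_const a]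
    exact ih.map_avg hinv α.isLocalWeight_transProb (α.bddMeasurable_iterate_avg hh l) (.const a)

/-- Removing from `l` steps of the walk the event, of weight `ε ^ l`, that the walk rests. -/
lemma Dominated.iterate_avg_sub_rest {h : Env E d → ℝ} {a ε : ℝ} (H : α.Dominated P h fun _ => a)
    (hinv : TranslationInvariant P) (hell : α.EllipticInTime) (hε : 0 ≤ ε)
    (hle : ∀ η, ε ≤ α.transProb η 0) (hh : BddMeasurable h) (l : ℕ) :
    α.Dominated P (fun η => (avg R α.transProb)^[l] h η - ε ^ l * h (shift 0 l η))
      fun _ => (1 - ε ^ l) * a := by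
  -- With T the averaging operator and θ the unit time shift, T^(l+1) h - ε^(l+1) h∘θ^(l+1) = ε (T^l
  -- h - ε^l h∘θ^l)∘θ + (T T^l h - ε (T^l h)∘θ). The bounds add up: ε(1 - ε^l)a + (1 - ε)a = (1 -
  -- ε^(l+1))a.
  induction l with
  | zero =>
    refine Dominated.of_abs_le (fun η => ?_) ?_ (.const _)
    · simp
    · simpa using BddMeasurable.const 0
  | succ l ih =>
    have hT := α.bddMeasurable_iterate_avg hh l
    have hN : BddMeasurable fun η => (avg R α.transProb)^[l] h η - ε ^ l * h (shift 0 l η) :=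
      hT.sub ((BddMeasurable.const _).mul (hh.comp_shift 0 l))
    have h1 := ih.map_avg hinv (hell.isLocalWeight_stayWeight hε) hN (.const _)
    have h2 := (H.iterate_avg hinv hh l).map_avg hinv (α.isLocalWeight_transProb_sub hε hle) hT
      (.const a)
    rw [avg_stayWeight, avg_stayWeight] at h1
    rw [avg_transProb_sub, avg_transProb_sub, avg_transProb_const] at h2
    have := h1.add h2 ((BddMeasurable.const _).mul (hN.comp_shift 0 1))
      ((α.bddMeasurable_avg_transProb hT).sub ((BddMeasurable.const _).mul (hT.comp_shift 0 1)))
      (.const _) (.const _)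
    convert this using 1
    · funext η
      rw [Function.iterate_succ_apply', shift_shift]
      push_cast
      rw [add_zero, add_comm (1 : ℤ)]
      ring
    · funext η
      ring

/-- The mean displacement after any observation of the past, if resting for `l` steps makes it
nearly independent of the past. -/
lemma dominated_mean_sub (hinv : TranslationInvariant P) (hell : α.EllipticInTime) {ε c : ℝ}
    (hε : 0 < ε) (hε1 : ε ≤ 1) (hle : ∀ η, ε ≤ α.transProb η 0) (hc : 0 ≤ c) {l : ℕ} (hl : 1 ≤ l)
    (hmix : ∀ n : ℕ, α.Dominated P
      (fun η => α.mean i n (shift 0 l η) - ∫ σ, α.mean i n σ ∂P) fun _ => n * c) (n : ℕ) :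
    α.Dominated P (fun η => α.mean i n η - ∫ σ, α.mean i n σ ∂P)
      fun _ => 2 * R * l / ε ^ l + n * c := by
  have hp : 0 < ε ^ l := pow_pos hε l
  have hp1 : ε ^ l ≤ 1 := pow_le_one₀ hε.le hε1
  have hC : 2 * R * l ≤ 2 * R * l / ε ^ l := by
    rw [le_div_iff₀ hp]
    exact mul_le_of_le_one_right (by positivity) hp1
  have hbm : ∀ (n : ℕ), BddMeasurable fun η => α.mean i n η - ∫ σ, α.mean i n σ ∂P :=
    fun n => (α.bddMeasurable_mean i n).sub (.const _)
  induction n using Nat.strong_induction_on with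
  | _ n ih =>
    rcases Nat.lt_or_ge n l with hn | hn
    · refine Dominated.of_abs_le (fun η => ?_) (hbm n) (.const _)
      have h1 := α.abs_mean_le i n η
      have h2 : |∫ σ, α.mean i n σ ∂P| ≤ R * n :=
        abs_integral_le_of_abs_le (α.abs_mean_le i n)
      have h3 : (R : ℝ) * n ≤ R * l := by gcongr
      have h4 : (0 : ℝ) ≤ n * c := by positivity
      calc _ ≤ |α.mean i n η| + |∫ σ, α.mean i n σ ∂P| := abs_sub _ _
        _ ≤ _ := by linarith
    -- Three contributions: `A`, the walk does not rest throughout the first `l` steps (induction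
    -- hypothesis); `B`, it rests (mixing); `D`, the displacement in those steps and the change of
    -- the constant, each at most `R * l`.
    · obtain ⟨n, rfl⟩ : ∃ m, n = m + l := ⟨n - l, by omega⟩
      have H := ih n (by omega)
      have A := H.iterate_avg_sub_rest hinv hell hε.le hle (hbm n) l
      have B := (hmix n).const_mul hp.le
      have D : α.Dominated P (fun η => (α.mean i (n + l) η -
          (avg R α.transProb)^[l] (α.mean i n) η) -
          ((∫ σ, α.mean i (n + l) σ ∂P) - ∫ σ, α.mean i n σ ∂P)) fun _ => 2 * R * l := by
        refine Dominated.of_abs_le (fun η => ?_) (((α.bddMeasurable_mean i _).sub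
          (α.bddMeasurable_iterate_avg (α.bddMeasurable_mean i n) l)).sub (.const _)) (.const _)
        have h1 := α.abs_mean_add_sub_avg_le i n l η
        have h2 : |(∫ σ, α.mean i (n + l) σ ∂P) - ∫ σ, α.mean i n σ ∂P| ≤ R * l := by
          rw [← integral_sub ((α.bddMeasurable_mean i _).integrable P)
            ((α.bddMeasurable_mean i _).integrable P)]
          exact abs_integral_le_of_abs_le (α.abs_mean_add_sub_le i n l)
        exact (abs_sub _ _).trans (by linarith)
      have hA : BddMeasurable fun η => (avg R α.transProb)^[l]
          (fun η => α.mean i n η - ∫ σ, α.mean i n σ ∂P) η -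
          ε ^ l * (α.mean i n (shift 0 l η) - ∫ σ, α.mean i n σ ∂P) :=
        (α.bddMeasurable_iterate_avg (hbm n) l).sub
          ((BddMeasurable.const _).mul ((hbm n).comp_shift 0 l))
      have hB : BddMeasurable fun η => ε ^ l * (α.mean i n (shift 0 l η) -
          ∫ σ, α.mean i n σ ∂P) := (BddMeasurable.const _).mul ((hbm n).comp_shift 0 l)
      have hD : BddMeasurable fun η => (α.mean i (n + l) η -
          (avg R α.transProb)^[l] (α.mean i n) η) -
          ((∫ σ, α.mean i (n + l) σ ∂P) - ∫ σ, α.mean i n σ ∂P) :=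
        ((α.bddMeasurable_mean i _).sub
          (α.bddMeasurable_iterate_avg (α.bddMeasurable_mean i n) l)).sub (.const _)
      have S := (A.add B hA hB (.const _) (.const _)).add D (hA.add hB) hD (.const _) (.const _)
      have hS : (fun η => α.mean i (n + l) η - ∫ σ, α.mean i (n + l) σ ∂P) = fun η =>
          (avg R α.transProb)^[l] (fun η => α.mean i n η - ∫ σ, α.mean i n σ ∂P) η -
          ε ^ l * (α.mean i n (shift 0 l η) - ∫ σ, α.mean i n σ ∂P) +
          ε ^ l * (α.mean i n (shift 0 l η) - ∫ σ, α.mean i n σ ∂P) +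
          ((α.mean i (n + l) η - (avg R α.transProb)^[l] (α.mean i n) η) -
          ((∫ σ, α.mean i (n + l) σ ∂P) - ∫ σ, α.mean i n σ ∂P)) := by
        funext η
        rw [iterate_avg_transProb_sub]
        ring
      rw [hS]
      refine S.mono (.const _) (.const _) fun η => ?_
      -- The constant `2 * R * l / ε ^ l` is chosen so that the gain from resting exactly pays for
      -- `D`.
      have h5 : ε ^ l * (2 * R * l / ε ^ l) = 2 * R * l := by field_simp
      have h6 : (0 : ℝ) ≤ l * c := by positivity
      push_cast
      linarith

end JumpRule

/-! ### Using the mixing condition. -/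

/-- Measures which are uniformly close on a `σ`-algebra have close integrals. -/
lemma abs_integral_sub_integral_le {Ω : Type*} {m m₀ : MeasurableSpace Ω} (hm : m ≤ m₀)
    {P Q : Measure[m₀] Ω} [IsProbabilityMeasure P] [IsProbabilityMeasure Q] {f : Ω → ℝ} {b φ : ℝ}
    (hf : Measurable[m] f) (hb : ∀ ω, |f ω| ≤ b)
    (hφ : ∀ B, MeasurableSet[m] B → |Q.real B - P.real B| ≤ φ) :
    |∫ ω, f ω ∂Q - ∫ ω, f ω ∂P| ≤ 2 * b * φ := by
  have hf₀ : Measurable[m₀] f := hf.mono hm le_rfl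
  have hb0 : 0 ≤ b := by
    obtain ⟨ω⟩ := P.nonempty_of_neZero
    exact (abs_nonneg _).trans (hb ω)
  -- Layer-cake formula for `f + b`, which takes values in [0, 2b]; its level sets belong to the
  -- small σ-algebra.
  have hlayer : ∀ (μ : Measure[m₀] Ω) [IsProbabilityMeasure μ],
      ∫ ω, f ω ∂μ = (∫ t in Set.Ioc 0 (2 * b), μ.real {ω | t ≤ f ω + b}) - b := by
    intro μ _
    have hint : Integrable f μ := Integrable.of_bound hf₀.aestronglyMeasurable b (ae_of_all _ hb)
    have h := (hint.add (integrable_const b)).integral_eq_integral_Ioc_meas_le (M := 2 * b)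
      (ae_of_all _ fun ω => by
        have := (abs_le.1 (hb ω)).1
        simp only [Pi.zero_apply, Pi.add_apply]
        linarith)
      (ae_of_all _ fun ω => by
        have := (abs_le.1 (hb ω)).2
        simp only [Pi.add_apply]
        linarith)
    simp only [Pi.add_apply] at h
    rw [← h, integral_add hint (integrable_const b)]
    simp
  have hanti : ∀ (μ : Measure[m₀] Ω) [IsProbabilityMeasure μ],
      IntegrableOn (fun t => μ.real {ω | t ≤ f ω + b}) (Set.Ioc 0 (2 * b)) := by
    intro μ _
    have : Antitone fun t => μ.real {ω | t ≤ f ω + b} := fun s t hst =>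
      measureReal_mono fun ω (hω : t ≤ _) => hst.trans hω
    exact (this.locallyIntegrable.integrableOn_isCompact isCompact_Icc).mono_set
      Set.Ioc_subset_Icc_self
  rw [hlayer Q, hlayer P, sub_sub_sub_cancel_right, ← integral_sub (hanti Q) (hanti P)]
  have h := norm_setIntegral_le_of_norm_le_const (μ := volume) (s := Set.Ioc 0 (2 * b)) (C := φ)
    (f := fun t => Q.real {ω | t ≤ f ω + b} - P.real {ω | t ≤ f ω + b}) measure_Ioc_lt_top
    (fun t _ => hφ _ (hf.add_const b measurableSet_Ici))
  rw [Real.norm_eq_abs] at h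
  refine h.trans_eq ?_
  rw [Real.volume_real_Ioc_of_le (by linarith)]
  ring

lemma integral_cond_eq {Ω : Type*} [MeasurableSpace Ω] {P : Measure Ω} {A : Set Ω} (f : Ω → ℝ) :
    ∫ ω, f ω ∂(ProbabilityTheory.cond P A) = (P.real A)⁻¹ * ∫ ω in A, f ω ∂P := by
  rw [ProbabilityTheory.cond, integral_smul_measure, ENNReal.toReal_inv]
  rfl

namespace JumpRule

open Env

variable {E : Type*} {d R : ℕ}

lemma ConeMixing.exists_le [MeasurableSpace E] {α : JumpRule E d R} {P : Measure (Env E d)}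
    (h : α.ConeMixing P) {φ : ℝ} (hφ : 0 < φ) (l₀ : ℕ) :
    ∃ l, l₀ ≤ l ∧
      ∀ B, MeasurableSet[cylinderEvents (X := fun _ : Site d × ℤ => E) (coneFrom d R l)] B →
      ∀ A ∈ α.pastObservations P, |(cond P A).real B - P.real B| ≤ φ := by
  have h1 := (h.eventually (gt_mem_nhds (ENNReal.ofReal_pos.2 hφ))).and (eventually_ge_atTop l₀)
  obtain ⟨l, hl, hl₀⟩ := h1.exists
  refine ⟨l, hl₀, fun B hB A hA => ?_⟩
  have h2 : ENNReal.ofReal |(cond P A).real B - P.real B| ≤ ENNReal.ofReal φ := by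
    refine le_trans ?_ hl.le
    refine le_trans ?_ (le_iSup₂ (f := fun B (_ : MeasurableSet[cylinderEvents
      (X := fun _ : Site d × ℤ => E) (coneFrom d R l)] B) =>
      ⨆ A ∈ α.pastObservations P, ENNReal.ofReal |(cond P A).real B - P.real B|) B hB)
    exact le_iSup₂ (f := fun A (_ : A ∈ α.pastObservations P) =>
      ENNReal.ofReal |(cond P A).real B - P.real B|) A hA
  exact (ENNReal.ofReal_le_ofReal_iff hφ.le).1 h2

variable (α : JumpRule E d R)
  [Finite E] [MeasurableSpace E] [MeasurableSingletonClass E]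

lemma cylinderEvents_measurable_transProb {Δ : Set (Site d × ℤ)} {x : Site d} {t : ℤ}
    (h : ∀ y ∈ box d R, (y + x, t) ∈ Δ) (z : Site d) :
    Measurable[cylinderEvents (X := fun _ : Site d × ℤ => E) Δ]
      fun η : Env E d => α.transProb (shift x t η) z := by
  have : Finite (box d R) := finite_box d R
  obtain ⟨g, hg⟩ := (α.isLocalWeight_transProb.isLocal_apply z).exists_eq_comp_slice
  have hg' : (fun η => α.transProb (shift x t η) z) =
      g ∘ fun η (y : box d R) => η (y.1 + x, t) := by
    funext η
    have := congrFun hg (shift x t η)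
    rw [this]
    simp only [Function.comp_apply]
    congr 1
    funext y
    simp [slice, shift]
  rw [hg']
  refine (measurable_of_countable g).comp ?_
  refine @measurable_pi_lambda _ _ _ (cylinderEvents (X := fun _ : Site d × ℤ => E) Δ) _ _
    fun y => ?_
  exact measurable_cylinderEvent_apply (X := fun _ : Site d × ℤ => E) (h y.1 y.2)

/-- A walk started in the cone, far enough from its boundary, only sees the cone. -/
lemma cylinderEvents_measurable_mean (i : Fin d) (l n : ℕ) {x : Site d} {t : ℤ} (ht : (l : ℤ) ≤ t)
    (hx : x.norm1 + d * R ≤ (R + 1) * t) :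
    Measurable[cylinderEvents (X := fun _ : Site d × ℤ => E) (coneFrom d R l)]
      fun η : Env E d => α.mean i n (shift x t η) := by
  induction n generalizing x t with
  | zero => exact @measurable_const _ _ _ (_) _
  | succ n ih =>
    simp only [mean, shift_shift]
    -- The condition on `(x, t)` persists: a step adds at most `R` on the left and `R + 1` on the
    -- right. The term `d * R` makes room for the observed box around the walker.
    refine Finset.measurable_fun_sum _ fun z hz => ?_
    have hz := mem_jumps.1 hz
    have h1 := Site.norm1_add_le x z
    refine Measurable.mul (m := cylinderEvents (X := fun _ : Site d × ℤ => E) (coneFrom d R l))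
      (α.cylinderEvents_measurable_transProb (fun y hy => ?_) z)
      (Measurable.const_add (m := cylinderEvents (X := fun _ : Site d × ℤ => E) (coneFrom d R l))
        (ih (by omega) (by linarith)) _)
    have h2 := Site.norm1_add_le y x
    have h3 := Site.norm1_le_of_mem_box hy
    refine ⟨⟨?_, ?_⟩, ht⟩
    · exact (Int.natCast_nonneg l).trans ht
    · dsimp only
      linarith

variable {α} {P : Measure (Env E d)} [IsProbabilityMeasure P]

lemma dominated_mean_shift_sub (hinv : TranslationInvariant P) (i : Fin d) {l : ℕ} (hl : d * R ≤ l)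
    {φ : ℝ} (hφ0 : 0 ≤ φ)
    (hφ : ∀ B, MeasurableSet[cylinderEvents (X := fun _ : Site d × ℤ => E) (coneFrom d R l)] B →
      ∀ A ∈ α.pastObservations P, |(cond P A).real B - P.real B| ≤ φ) (n : ℕ) :
    α.Dominated P (fun η => α.mean i n (shift 0 l η) - ∫ σ, α.mean i n σ ∂P)
      fun _ => n * (2 * R * φ) := by
  have hmean : ∫ σ, α.mean i n σ ∂P = ∫ η, α.mean i n (shift 0 l η) ∂P := by
    conv_lhs => rw [← (hinv 0 l).map_eq]
    exact integral_map (hinv 0 l).measurable.aemeasurable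
      (α.bddMeasurable_mean i n).1.aestronglyMeasurable
  have hbm := (α.bddMeasurable_mean i n).comp_shift 0 l
  intro k γ hγ σ
  rw [integral_sub (hbm.integrable _) (integrable_const _), setIntegral_const, setIntegral_const,
    smul_eq_mul, smul_eq_mul, hmean]
  -- Without any observation there is nothing to mix: the two means agree by translation invariance.
  rcases Nat.eq_zero_or_pos k with rfl | hk
  · rw [observation_zero]
    simp only [Measure.restrict_univ, probReal_univ, one_mul, sub_self, abs_zero]
    positivity
  set A := observation R k γ σ with hA
  rcases eq_or_ne (P A) 0 with hPA | hPA
  · have : P.real A = 0 := by simp [measureReal_def, hPA]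
    rw [this, Measure.restrict_eq_zero.2 hPA]
    simp
  have hPA' : 0 < P.real A := ENNReal.toReal_pos hPA (measure_ne_top _ _)
  have : IsProbabilityMeasure (cond P A) := cond_isProbabilityMeasure hPA
  have hmem : A ∈ α.pastObservations P := ⟨k, hk, γ, hγ, σ, hA, pos_iff_ne_zero.2 hPA⟩
  have h := abs_integral_sub_integral_le (P := P) (Q := cond P A)
    (cylinderEvents_le_pi (X := fun _ : Site d × ℤ => E) (Δ := coneFrom d R l))
    (α.cylinderEvents_measurable_mean i l n (x := 0) (t := l) le_rfl (by
      have : (d * R : ℤ) ≤ l := by exact_mod_cast hl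
      have h0 : (0 : ℤ) ≤ R * l := by positivity
      simp only [Site.norm1, Pi.zero_apply, abs_zero, Finset.sum_const_zero]
      linarith))
    (fun η => α.abs_mean_le i n _) (fun B hB => hφ B hB A hmem)
  rw [integral_cond_eq] at h
  have h2 : ∫ η in A, α.mean i n (shift 0 l η) ∂P -
      P.real A * ∫ η, α.mean i n (shift 0 l η) ∂P =
      P.real A * ((P.real A)⁻¹ * ∫ η in A, α.mean i n (shift 0 l η) ∂P -
        ∫ η, α.mean i n (shift 0 l η) ∂P) := by
    field_simp
  rw [h2, abs_mul, abs_of_pos hPA']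
  refine mul_le_mul_of_nonneg_left (h.trans_eq ?_) hPA'.le
  ring

/-- Uniformly over the observed past, the mean speed of the walk over long times is nearly
deterministic. -/
lemma exists_dominated_mean_sub (hinv : TranslationInvariant P) (hmix : α.ConeMixing P)
    (hell : α.EllipticInTime) (i : Fin d) {δ : ℝ} (hδ : 0 < δ) :
    ∃ n : ℕ, 1 ≤ n ∧ α.Dominated P (fun η => α.mean i n η - ∫ σ, α.mean i n σ ∂P)
      fun _ => n * δ := by
  obtain ⟨ε, hε, hε1, hle⟩ := hell.exists_pos_le
  set φ : ℝ := δ / (4 * (R + 1)) with hφ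
  have hφ0 : 0 < φ := by positivity
  -- `d * R` puts the box around the resting walker inside the cone; the extra 1 makes the induction
  -- in steps of `l` progress.
  obtain ⟨l, hl, hlφ⟩ := hmix.exists_le hφ0 (d * R + 1)
  have H := dominated_mean_sub i hinv hell hε hε1 hle (c := 2 * R * φ) (by positivity) (l := l)
    (by omega) (dominated_mean_shift_sub hinv i (by omega) hφ0.le hlφ)
  -- Large `n` absorbs the constant term in half of `n * δ`; the choice of `φ` takes care of the
  -- other half.
  obtain ⟨n, hn⟩ := exists_nat_ge (2 * R * l / ε ^ l / (δ / 2))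
  refine ⟨n + 1, by omega, (H (n + 1)).mono (.const _) (.const _) fun _ => ?_⟩
  rw [div_le_iff₀ (by positivity)] at hn
  have h1 : 2 * R * φ ≤ δ / 2 := by
    rw [hφ, ← mul_div_assoc, div_le_iff₀ (by positivity)]
    nlinarith
  have h2 : ((n + 1 : ℕ) : ℝ) * (2 * R * φ) ≤ (n + 1 : ℕ) * (δ / 2) := by gcongr
  push_cast at h2 ⊢
  linarith

end JumpRule

/-! ### Deviations of sums with small conditional drift. -/

section Deviations

variable {Ω : Type*} [MeasurableSpace Ω] {μ : Measure Ω}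

/-- A conditional bound on the atoms of a countable partition extends to weighted integrals. -/
lemma integral_comp_mul_le {ι : Type*} [Countable ι] [MeasurableSpace ι]
    [MeasurableSingletonClass ι] {π : Ω → ι} (hπ : Measurable π) {g : ι → ℝ} (hg : ∀ c, 0 ≤ g c)
    {D : Ω → ℝ} {a : ℝ} (hD : ∀ c, ∫ ω in π ⁻¹' {c}, D ω ∂μ ≤ a * μ.real (π ⁻¹' {c}))
    (hint : Integrable (fun ω => g (π ω)) μ) (hint' : Integrable (fun ω => g (π ω) * D ω) μ) :
    ∫ ω, g (π ω) * D ω ∂μ ≤ a * ∫ ω, g (π ω) ∂μ := by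
  have hU : ⋃ c, π ⁻¹' {c} = Set.univ := by
    ext ω
    simp
  have hm : ∀ c, MeasurableSet (π ⁻¹' {c}) := fun c => hπ (measurableSet_singleton c)
  have hdisj : Pairwise (Function.onFun Disjoint fun c => π ⁻¹' {c}) := fun c c' hcc =>
    Set.disjoint_left.2 fun ω h h' => hcc (h.symm.trans h')
  have h1 := hasSum_integral_iUnion hm hdisj hint'.integrableOn
  have h2 := (hasSum_integral_iUnion hm hdisj hint.integrableOn).mul_left a
  rw [hU, setIntegral_univ] at h1 h2
  refine hasSum_le (fun c => ?_) h1 h2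
  have e1 : ∫ ω in π ⁻¹' {c}, g (π ω) * D ω ∂μ = g c * ∫ ω in π ⁻¹' {c}, D ω ∂μ := by
    rw [← integral_const_mul]
    exact setIntegral_congr_fun (hm c) fun ω (hω : π ω = c) => by simp only [hω]
  have e2 : ∫ ω in π ⁻¹' {c}, g (π ω) ∂μ = g c * μ.real (π ⁻¹' {c}) := by
    rw [setIntegral_congr_fun (g := fun _ => g c) (hm c)
      fun ω (hω : π ω = c) => by simp only [hω], setIntegral_const, smul_eq_mul, mul_comm]
  rw [e1, e2, mul_left_comm]
  exact mul_le_mul_of_nonneg_left (hD c) (hg c)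

variable [IsProbabilityMeasure μ]

/-- Sums of bounded random variables whose conditional means given the past are at most `a`
eventually stay below `2 a K`. -/
lemma ae_eventually_sum_lt {D : ℕ → Ω → ℝ} (hDm : ∀ k, Measurable (D k)) {a B : ℝ} (ha : 0 < a)
    (haB : a ≤ B) (hB1 : 1 ≤ B) (hB : ∀ k, ∀ᵐ ω ∂μ, |D k ω| ≤ B) {ι : ℕ → Type*}
    [∀ k, Countable (ι k)] [∀ k, MeasurableSpace (ι k)] [∀ k, MeasurableSingletonClass (ι k)]
    {π : ∀ k, Ω → ι k} (hπ : ∀ k, Measurable (π k))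
    (hfac : ∀ k, ∃ g : ι k → ℝ, ∀ ω, ∑ j ∈ Finset.range k, D j ω = g (π k ω))
    (hD : ∀ k c, ∫ ω in π k ⁻¹' {c}, D k ω ∂μ ≤ a * μ.real (π k ⁻¹' {c})) :
    ∀ᵐ ω ∂μ, ∀ᶠ K : ℕ in atTop, ∑ j ∈ Finset.range K, D j ω < 2 * a * K := by
  have hB0 : 0 < B := by linarith
  -- This minimizes the exponent -2as + (sa + s²B²) in the Chernoff bound, with minimum -a²/(4B²).
  -- It also gives sB ≤ 1, as needed for e^x ≤ 1 + x + x².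
  set s : ℝ := a / (2 * B ^ 2) with hs
  have hs0 : 0 < s := by positivity
  have hsB : s * B ≤ 1 := by
    rw [hs, div_mul_eq_mul_div, div_le_one (by positivity)]
    nlinarith
  set S : ℕ → Ω → ℝ := fun K ω => ∑ j ∈ Finset.range K, D j ω with hS
  have hSm : ∀ K, Measurable (S K) := fun K => Finset.measurable_fun_sum _ fun j _ => hDm j
  have hSB : ∀ K, ∀ᵐ ω ∂μ, |S K ω| ≤ K * B := fun K => by
    filter_upwards [ae_all_iff.2 hB] with ω hω
    calc |S K ω| ≤ ∑ j ∈ Finset.range K, |D j ω| := Finset.abs_sum_le_sum_abs _ _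
      _ ≤ ∑ j ∈ Finset.range K, B := Finset.sum_le_sum fun j _ => hω j
      _ = K * B := by simp
  have hexpint : ∀ K, Integrable (fun ω => Real.exp (s * S K ω)) μ := fun K => by
    refine Integrable.of_bound ((hSm K).const_mul s).exp.aestronglyMeasurable
      (Real.exp (s * (K * B))) ?_
    filter_upwards [hSB K] with ω hω
    rw [Real.norm_eq_abs, Real.abs_exp, Real.exp_le_exp]
    exact mul_le_mul_of_nonneg_left ((le_abs_self _).trans hω) hs0.le
  have hmulint : ∀ K, Integrable (fun ω => Real.exp (s * S K ω) * D K ω) μ := fun K => by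
    have := (hexpint K).bdd_mul (hDm K).aestronglyMeasurable (hB K)
    simpa only [mul_comm] using this
  have hmgf : ∀ K : ℕ, mgf (S K) μ s ≤ Real.exp (K * (s * a + s ^ 2 * B ^ 2)) := by
    intro K
    induction K with
    | zero => simp [mgf, hS]
    | succ K ih =>
      obtain ⟨g, hg⟩ := hfac K
      have hstep : mgf (S (K + 1)) μ s ≤ ∫ ω, (Real.exp (s * S K ω) * (1 + s ^ 2 * B ^ 2) +
          s * (Real.exp (s * S K ω) * D K ω)) ∂μ := by
        refine integral_mono_ae (hexpint (K + 1))
          (((hexpint K).mul_const _).add ((hmulint K).const_mul s)) ?_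
        filter_upwards [hB K] with ω hω
        have hx : |s * D K ω| ≤ s * B := by
          rw [abs_mul, abs_of_pos hs0]
          exact mul_le_mul_of_nonneg_left hω hs0.le
        have h1 := (abs_le.1 (Real.abs_exp_sub_one_sub_id_le (hx.trans hsB))).2
        have h2 : (s * D K ω) ^ 2 ≤ (s * B) ^ 2 := sq_le_sq' (by
          linarith [(abs_le.1 hx).1]) (abs_le.1 hx).2
        have h3 : S (K + 1) ω = S K ω + D K ω := Finset.sum_range_succ _ _
        have h4 : Real.exp (s * D K ω) ≤ 1 + s ^ 2 * B ^ 2 + s * D K ω := by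
          linarith [mul_pow s B 2]
        rw [h3, mul_add, Real.exp_add]
        calc Real.exp (s * S K ω) * Real.exp (s * D K ω)
            ≤ Real.exp (s * S K ω) * (1 + s ^ 2 * B ^ 2 + s * D K ω) :=
              mul_le_mul_of_nonneg_left h4 (Real.exp_pos _).le
          _ = _ := by ring
      have hcond : ∫ ω, Real.exp (s * S K ω) * D K ω ∂μ ≤ a * mgf (S K) μ s := by
        have := integral_comp_mul_le (μ := μ) (hπ K) (g := fun c => Real.exp (s * g c))
          (fun c => (Real.exp_pos _).le) (hD K) (by simpa only [hS, hg] using hexpint K)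
          (by simpa only [hS, hg] using hmulint K)
        simpa only [mgf, hS, hg] using this
      rw [integral_add ((hexpint K).mul_const _) ((hmulint K).const_mul s), integral_mul_const,
        integral_const_mul] at hstep
      have hM : 0 ≤ mgf (S K) μ s := mgf_nonneg
      have h5 : 1 + (s * a + s ^ 2 * B ^ 2) ≤ Real.exp (s * a + s ^ 2 * B ^ 2) := by
        linarith [Real.add_one_le_exp (s * a + s ^ 2 * B ^ 2)]
      calc mgf (S (K + 1)) μ s
          ≤ mgf (S K) μ s * (1 + s ^ 2 * B ^ 2) + s * (a * mgf (S K) μ s) :=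
            hstep.trans (add_le_add le_rfl (mul_le_mul_of_nonneg_left hcond hs0.le))
        _ = mgf (S K) μ s * (1 + (s * a + s ^ 2 * B ^ 2)) := by ring
        _ ≤ Real.exp (K * (s * a + s ^ 2 * B ^ 2)) * Real.exp (s * a + s ^ 2 * B ^ 2) :=
            mul_le_mul ih h5 (by positivity) (Real.exp_pos _).le
        _ = _ := by
            rw [← Real.exp_add]
            push_cast
            ring_nf
  set c : ℝ := -(a ^ 2 / (4 * B ^ 2)) with hc
  have hc0 : c < 0 := by
    rw [hc, neg_lt_zero]
    positivity
  have hprob : ∀ K : ℕ, μ {ω | 2 * a * K ≤ S K ω} ≤ ENNReal.ofReal (Real.exp (K * c)) := by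
    intro K
    rw [← ofReal_measureReal]
    refine ENNReal.ofReal_le_ofReal ?_
    refine (measure_ge_le_exp_mul_mgf _ hs0.le (hexpint K)).trans ?_
    calc Real.exp (-s * (2 * a * K)) * mgf (S K) μ s
        ≤ Real.exp (-s * (2 * a * K)) * Real.exp (K * (s * a + s ^ 2 * B ^ 2)) :=
          mul_le_mul_of_nonneg_left (hmgf K) (Real.exp_pos _).le
      _ = Real.exp (K * c) := by
          rw [← Real.exp_add, hc, hs]
          congr 1
          field_simp
          ring
  have hsum : ∑' K : ℕ, μ {ω | 2 * a * K ≤ S K ω} ≠ ⊤ :=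
    ne_top_of_le_ne_top (Real.summable_exp_nat_mul_iff.2 hc0).tsum_ofReal_ne_top
      (ENNReal.tsum_le_tsum hprob)
  filter_upwards [ae_eventually_notMem hsum] with ω hω
  filter_upwards [hω] with K hK
  simpa using hK

end Deviations

/-! ### Path cylinders and the displacement given the past trajectory. -/

/-- The trajectories which agree with `x` up to time `t`. -/
def pathCylinder {d : ℕ} (t : ℕ) (x : ℕ → Site d) : Set (ℕ → Site d) := {X | ∀ i ≤ t, X i = x i}

lemma pathCylinder_eq_preimage {d : ℕ} (t : ℕ) (x : ℕ → Site d) :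
    pathCylinder t x = Preorder.frestrictLe (π := fun _ => Site d) t ⁻¹'
      {Preorder.frestrictLe (π := fun _ => Site d) t x} := by
  ext X
  simp only [pathCylinder, Set.mem_ofPred_eq, Set.mem_preimage, Set.mem_singleton_iff, funext_iff,
    Preorder.frestrictLe_apply, Subtype.forall, Finset.mem_Iic]

lemma measurableSet_pathCylinder {d : ℕ} (t : ℕ) (x : ℕ → Site d) :
    MeasurableSet (pathCylinder t x) := by
  rw [pathCylinder_eq_preimage]
  exact (by fun_prop : Measurable (Preorder.frestrictLe (π := fun _ => Site d) t))
    (measurableSet_singleton _)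

lemma exists_frestrictLe_eq {d : ℕ} {t : ℕ} (h : (i : Finset.Iic t) → Site d) :
    ∃ x : ℕ → Site d, Preorder.frestrictLe (π := fun _ => Site d) t x = h := by
  refine ⟨fun i => if hi : i ≤ t then h ⟨i, Finset.mem_Iic.2 hi⟩ else 0, ?_⟩
  funext ⟨i, hi⟩
  simp [Finset.mem_Iic.1 hi]

namespace JumpRule

open Env

variable {E : Type*} {d R : ℕ} (α : JumpRule E d R)

/-- The quenched probability of following the path `x` from its first point during `t` steps. -/
noncomputable def pathWeight (x : ℕ → Site d) (t : ℕ) (η : Env E d) : ℝ :=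
  ∏ j ∈ Finset.range t, α.transProb (shift (x j) j η) (x (j + 1) - x j)

lemma quenchedLaw_real_pathCylinder (η : Env E d) (t : ℕ) (x : ℕ → Site d) :
    (α.quenchedLaw η).real (pathCylinder t x) = if x 0 = 0 then α.pathWeight x t η else 0 := by
  rw [measureReal_def, pathCylinder, quenchedLaw_cylinder]
  split_ifs
  · rw [ENNReal.toReal_prod]
    rfl
  · rfl

lemma ae_quenchedLaw_zero (η : Env E d) : ∀ᵐ X ∂α.quenchedLaw η, X 0 = 0 := by
  have h := α.quenchedLaw_real_pathCylinder η 0 fun _ => 0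
  rw [if_pos rfl, pathWeight, Finset.prod_range_zero, measureReal_def,
    ENNReal.toReal_eq_one_iff, ← mem_ae_iff_prob_eq_one (measurableSet_pathCylinder _ _)] at h
  filter_upwards [h] with X hX
  exact hX 0 le_rfl

lemma ae_quenchedLaw_norm1_le (η : Env E d) (t : ℕ) :
    ∀ᵐ X ∂α.quenchedLaw η, (X (t + 1) - X t).norm1 ≤ (R : ℤ) := by
  rw [ae_iff]
  have hsub : {X : ℕ → Site d | ¬ (X (t + 1) - X t).norm1 ≤ R} ⊆
      ⋃ h : {h : (i : Finset.Iic (t + 1)) → Site d //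
        ¬ (h ⟨t + 1, by simp⟩ - h ⟨t, by simp⟩).norm1 ≤ R},
        Preorder.frestrictLe (π := fun _ => Site d) (t + 1) ⁻¹' {h.1} := fun X hX =>
    Set.mem_iUnion.2 ⟨⟨Preorder.frestrictLe (π := fun _ => Site d) (t + 1) X, hX⟩, rfl⟩
  refine measure_mono_null hsub (measure_iUnion_null fun ⟨h, hh⟩ => ?_)
  obtain ⟨x, rfl⟩ := exists_frestrictLe_eq h
  rw [← pathCylinder_eq_preimage]
  refine (measureReal_eq_zero_iff).1 ?_
  rw [quenchedLaw_real_pathCylinder]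
  split_ifs
  · refine Finset.prod_eq_zero (i := t) (by simp) (α.transProb_eq_zero ?_)
    rw [mem_jumps]
    exact hh
  · rfl

lemma abs_sub_le_of_norm1_le {X : ℕ → Site d} (hX : ∀ t, (X (t + 1) - X t).norm1 ≤ R) (i : Fin d)
    (t n : ℕ) : |(X (t + n) i : ℝ) - X t i| ≤ R * n := by
  induction n with
  | zero => simp
  | succ n ih =>
    have h : |(X (t + n + 1) i : ℝ) - X (t + n) i| ≤ R := by
      exact_mod_cast (Site.abs_apply_le_norm1 (X (t + n + 1) - X (t + n)) i).trans (hX (t + n))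
    push_cast
    calc |(X (t + (n + 1)) i : ℝ) - X t i|
        ≤ |(X (t + n + 1) i : ℝ) - X (t + n) i| + |(X (t + n) i : ℝ) - X t i| := abs_sub_le _ _ _
      _ ≤ R * (n + 1) := by linarith

lemma measurable_displacement (i : Fin d) (t n : ℕ) :
    Measurable fun X : ℕ → Site d => (X (t + n) i : ℝ) - X t i := by
  have : ∀ s, Measurable fun X : ℕ → Site d => (X s i : ℝ) := fun s =>
    (measurable_of_countable (fun z : Site d => (z i : ℝ))).comp (measurable_pi_apply s)
  exact (this _).sub (this _)

lemma integrable_displacement (η : Env E d) (i : Fin d) (t n : ℕ) :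
    Integrable (fun X : ℕ → Site d => (X (t + n) i : ℝ) - X t i) (α.quenchedLaw η) := by
  refine Integrable.of_bound (measurable_displacement i t n).aestronglyMeasurable (R * n) ?_
  filter_upwards [ae_all_iff.2 (α.ae_quenchedLaw_norm1_le η)] with X hX
  exact abs_sub_le_of_norm1_le hX i t n

lemma pathCylinder_succ (t : ℕ) (x : ℕ → Site d) (z : Site d) :
    pathCylinder (t + 1) (Function.update x (t + 1) (x t + z)) =
      pathCylinder t x ∩ {X | X (t + 1) = x t + z} := by
  ext X
  simp only [pathCylinder, Set.mem_ofPred_eq, Set.mem_inter_iff]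
  constructor
  · intro h
    refine ⟨fun j hj => ?_, by simpa using h (t + 1) le_rfl⟩
    have := h j (by omega)
    rwa [Function.update_of_ne (by omega)] at this
  · rintro ⟨h, h'⟩ j hj
    rcases eq_or_ne j (t + 1) with rfl | hne
    · simpa using h'
    · rw [Function.update_of_ne hne]
      exact h j (by omega)

lemma pathWeight_update (t : ℕ) (x : ℕ → Site d) (z : Site d) (η : Env E d) :
    α.pathWeight (Function.update x (t + 1) (x t + z)) (t + 1) η =
      α.pathWeight x t η * α.transProb (shift (x t) t η) z := by
  rw [pathWeight, Finset.prod_range_succ, pathWeight]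
  congr 1
  · refine Finset.prod_congr rfl fun j hj => ?_
    have := Finset.mem_range.1 hj
    rw [Function.update_of_ne (by omega), Function.update_of_ne (by omega)]
  · rw [Function.update_self, Function.update_of_ne (by omega), add_sub_cancel_left]

/-- The Markov property for the mean displacement. -/
lemma setIntegral_displacement (η : Env E d) (i : Fin d) (n t : ℕ) (x : ℕ → Site d)
    (hx : x 0 = 0) :
    ∫ X in pathCylinder t x, ((X (t + n) i : ℝ) - X t i) ∂α.quenchedLaw η =
      α.pathWeight x t η * α.mean i n (shift (x t) t η) := by
  induction n generalizing t x with
  | zero => simp [mean]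
  | succ n ih =>
    set y : Site d → ℕ → Site d := fun z => Function.update x (t + 1) (x t + z) with hy
    -- Up to a null set the next jump lies in the finite set `jumps d R`.
    have hae : pathCylinder t x =ᵐ[α.quenchedLaw η]
        ⋃ z ∈ jumps d R, pathCylinder (t + 1) (y z) := by
      filter_upwards [α.ae_quenchedLaw_norm1_le η t] with X hX
      refine propext ⟨fun h => ?_, fun h => ?_⟩
      · have hXt : X t = x t := h t le_rfl
        refine Set.mem_biUnion (x := X (t + 1) - X t) (mem_jumps.2 hX) ?_
        rw [hy, pathCylinder_succ]
        exact ⟨h, by simp [hXt]⟩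
      · obtain ⟨z, _, hz⟩ := Set.mem_iUnion₂.1 h
        rw [hy, pathCylinder_succ] at hz
        exact hz.1
    rw [setIntegral_congr_set hae, integral_biUnion_finset _
      (fun z _ => measurableSet_pathCylinder _ _)]
    · simp only [mean, Finset.mul_sum]
      refine Finset.sum_congr rfl fun z _ => ?_
      have hyt : y z (t + 1) = x t + z := by simp [hy]
      have hcongr : ∫ X in pathCylinder (t + 1) (y z), ((X (t + (n + 1)) i : ℝ) - X t i)
            ∂α.quenchedLaw η =
          ∫ X in pathCylinder (t + 1) (y z), ((z i : ℝ) + ((X (t + 1 + n) i : ℝ) - X (t + 1) i))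
            ∂α.quenchedLaw η := by
        refine setIntegral_congr_fun (measurableSet_pathCylinder _ _) fun X hX => ?_
        rw [hy, pathCylinder_succ] at hX
        have h1 : X t = x t := hX.1 t le_rfl
        have h2 : X (t + 1) = x t + z := hX.2
        have h3 : t + (n + 1) = t + 1 + n := by omega
        simp only [h1, h2, h3, Pi.add_apply]
        push_cast
        ring
      rw [hcongr, integral_add (integrable_const _)
        (α.integrable_displacement η i (t + 1) n).integrableOn, setIntegral_const, smul_eq_mul,
        ih (t + 1) (y z) (by simpa [hy] using hx), quenchedLaw_real_pathCylinder,
        if_pos (by simpa [hy] using hx), hyt, pathWeight_update, shift_shift]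
      push_cast
      ring
    · intro z _ z' _ hzz
      refine Set.disjoint_left.2 fun X hX hX' => hzz ?_
      simp only [hy, pathCylinder_succ] at hX hX'
      exact add_left_cancel (hX.2.symm.trans hX'.2)
    · exact fun z _ => (α.integrable_displacement η i t (n + 1)).integrableOn

variable [Finite E] [MeasurableSpace E] [MeasurableSingletonClass E]

lemma bddMeasurable_pathWeight (x : ℕ → Site d) (t : ℕ) : BddMeasurable (α.pathWeight x t) := by
  induction t with
  | zero => 
    have : α.pathWeight x 0 = fun _ => 1 := by
      funext η
      simp [pathWeight]
    exact this ▸ BddMeasurable.const 1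
  | succ t ih =>
    unfold pathWeight at ih ⊢
    simp only [Finset.prod_range_succ]
    exact ih.mul ((α.isLocalWeight_transProb.bddMeasurable _).comp_shift _ _)

variable {α} {P : Measure (Env E d)} [IsProbabilityMeasure P]

/-- Following `x` means making the jump `x 1` and then following the recentred path. The first jump
is an averaging step with local weight concentrated on `x 1`, so `Dominated.map_avg` applies
inductively. -/
lemma Dominated.pathWeight_mul {h g : Env E d → ℝ} (H : α.Dominated P h g)
    (hinv : TranslationInvariant P) (hh : BddMeasurable h) (hg : BddMeasurable g) (t : ℕ)
    (x : ℕ → Site d) (hx : x 0 = 0) :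
    α.Dominated P (fun η => α.pathWeight x t η * h (shift (x t) t η))
      (fun η => α.pathWeight x t η * g (shift (x t) t η)) := by
  classical
  induction t generalizing x with
  | zero => simpa [pathWeight, hx] using H
  | succ t ih =>
    set y : ℕ → Site d := fun j => x (j + 1) - x 1 with hy
    have hβ : α.IsLocalWeight fun η z => if z = x 1 then α.transProb η z else 0 :=
      { nonneg := fun η z => by
          split_ifs
          exacts [α.transProb_nonneg η z, le_rfl]
        isLocal := fun η σ hησ => by
          simp only
          rw [α.isLocalWeight_transProb.isLocal η σ hησ]
        mem_jumpRange := fun η z hz =>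
          α.isLocalWeight_transProb.mem_jumpRange η z fun h0 => hz (by simp [h0]) }
    have key : ∀ f : Env E d → ℝ,
        avg R (fun η z => if z = x 1 then α.transProb η z else 0)
          (fun η => α.pathWeight y t η * f (shift (y t) t η)) =
        fun η => α.pathWeight x (t + 1) η * f (shift (x (t + 1)) (t + 1 : ℕ) η) := by
      intro f
      funext η
      have h1 : α.pathWeight x (t + 1) η =
          α.transProb η (x 1) * α.pathWeight y t (shift (x 1) 1 η) := by
        rw [pathWeight, Finset.prod_range_succ', pathWeight, mul_comm]
        congr 1
        · simp [hx]
        · refine Finset.prod_congr rfl fun j _ => ?_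
          rw [shift_shift]
          simp [hy, add_comm]
      have h2 : shift (y t) t (shift (x 1) 1 η) = shift (x (t + 1)) (t + 1 : ℕ) η := by
        rw [shift_shift]
        simp [hy, add_comm]
      simp only [avg, ite_mul, zero_mul, Finset.sum_ite_eq', h1, h2]
      split_ifs with hmem
      · ring
      · rw [α.transProb_eq_zero hmem]
        ring
    have hb : ∀ {f : Env E d → ℝ}, BddMeasurable f →
        BddMeasurable fun η => α.pathWeight y t η * f (shift (y t) t η) := fun hf =>
      (α.bddMeasurable_pathWeight y t).mul (hf.comp_shift _ _)
    have := (ih y (by simp [hy])).map_avg hinv hβ (hb hh) (hb hg)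
    rwa [key h, key g] at this

lemma ae_jointLaw (P : Measure (Env E d)) [IsProbabilityMeasure P] :
    ∀ᵐ ω ∂α.jointLaw P, ω.2 0 = 0 ∧ ∀ t, (ω.2 (t + 1) - ω.2 t).norm1 ≤ (R : ℤ) := by
  have hm : MeasurableSet {X : ℕ → Site d | X 0 = 0 ∧ ∀ t, (X (t + 1) - X t).norm1 ≤ (R : ℤ)} := by
    have : ∀ t, MeasurableSet {X : ℕ → Site d | (X (t + 1) - X t).norm1 ≤ (R : ℤ)} := fun t =>
      (by fun_prop : Measurable fun X : ℕ → Site d => X (t + 1) - X t)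
        (Set.to_countable {z : Site d | z.norm1 ≤ (R : ℤ)}).measurableSet
    simp only [Set.ofPred_and, Set.ofPred_forall]
    exact (measurable_pi_apply 0 (measurableSet_singleton _)).inter (.iInter this)
  refine Measure.ae_compProd_of_ae_ae (measurable_snd hm) (ae_of_all _ fun η => ?_)
  filter_upwards [α.ae_quenchedLaw_zero η, ae_all_iff.2 (α.ae_quenchedLaw_norm1_le η)] with X h h'
  exact ⟨h, h'⟩

instance : IsProbabilityMeasure (α.jointLaw P) := by
  unfold jointLaw
  infer_instance

lemma integrable_displacement_jointLaw (i : Fin d) (t n : ℕ) :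
    Integrable (fun ω => (ω.2 (t + n) i : ℝ) - ω.2 t i) (α.jointLaw P) := by
  refine Integrable.of_bound
    ((measurable_displacement i t n).comp measurable_snd).aestronglyMeasurable (R * n) ?_
  filter_upwards [ae_jointLaw P] with ω hω
  exact abs_sub_le_of_norm1_le hω.2 i t n

/-- The mean displacement of the walk given its past trajectory. -/
lemma abs_setIntegral_displacement_sub_le (hinv : TranslationInvariant P) (i : Fin d) {n : ℕ}
    {m a : ℝ} (H : α.Dominated P (fun η => α.mean i n η - m) fun _ => a) (t : ℕ)
    (x : ℕ → Site d) :
    |∫ ω in Prod.snd ⁻¹' pathCylinder t x, ((ω.2 (t + n) i : ℝ) - ω.2 t i - m) ∂α.jointLaw P| ≤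
      a * (α.jointLaw P).real (Prod.snd ⁻¹' pathCylinder t x) := by
  have hint : ∀ f : Env E d × (ℕ → Site d) → ℝ, Integrable f (α.jointLaw P) →
      ∫ ω in Prod.snd ⁻¹' pathCylinder t x, f ω ∂α.jointLaw P =
        ∫ η, ∫ X in pathCylinder t x, f (η, X) ∂α.quenchedLaw η ∂P := by
    intro f hf
    have := Measure.setIntegral_compProd (μ := P) (κ := α.quenchedKernel) MeasurableSet.univ
      (measurableSet_pathCylinder t x) (f := f) hf.integrableOn
    rw [Set.univ_prod, setIntegral_univ] at this
    exact this
  have h1 := hint (fun _ => 1) (integrable_const 1)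
  have h2 := hint _ ((integrable_displacement_jointLaw (α := α) (P := P) i t n).sub
    (integrable_const m))
  simp only [Pi.sub_apply] at h2
  rw [setIntegral_const, smul_eq_mul, mul_one] at h1
  rw [h1, h2]
  by_cases hx : x 0 = 0
  · have hcyl : ∀ η, (α.quenchedLaw η).real (pathCylinder t x) = α.pathWeight x t η := fun η => by
      rw [quenchedLaw_real_pathCylinder, if_pos hx]
    -- The observation of length 0 suffices here: the past of the walk is already encoded in the
    -- path weight.
    have h3 := (H.pathWeight_mul hinv ((α.bddMeasurable_mean i n).sub (.const m)) (.const a) t x hx)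
      0 (fun _ => 0) ⟨rfl, fun j hj => absurd hj (Nat.not_lt_zero j)⟩
      (Classical.choice P.nonempty_of_neZero)
    rw [observation_zero, setIntegral_univ, setIntegral_univ, integral_mul_const, mul_comm] at h3
    simp_rw [integral_sub (α.integrable_displacement _ i t n).integrableOn (integrable_const m),
      α.setIntegral_displacement _ i n t x hx, setIntegral_const, smul_eq_mul, mul_one, hcyl,
      ← mul_sub]
    exact h3
  · have hcyl : ∀ η, (α.quenchedLaw η) (pathCylinder t x) = 0 := fun η => by
      rw [← measureReal_eq_zero_iff, quenchedLaw_real_pathCylinder, if_neg hx]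
    simp [Measure.restrict_eq_zero.2 (hcyl _)]

/-! ### Existence of the velocity. -/

/-- The velocity is determined up to an arbitrarily small error. -/
lemma exists_ae_eventually_abs_sub_le (hinv : TranslationInvariant P) (hmix : α.ConeMixing P)
    (hell : α.EllipticInTime) (i : Fin d) {δ : ℝ} (hδ : 0 < δ) :
    ∃ u : ℝ, ∀ᵐ ω ∂α.jointLaw P, ∀ᶠ t : ℕ in atTop, |(ω.2 t i : ℝ) / t - u| ≤ δ := by
  -- With drift error δ/4 per unit of time, the sum over K blocks stays below 2aK = Knδ/2 ≤ tδ/2;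
  -- the other tδ/2 covers the incomplete last block.
  obtain ⟨n, hn, H⟩ := exists_dominated_mean_sub hinv hmix hell i (half_pos (half_pos hδ))
  have hn0 : (0 : ℝ) < n := by exact_mod_cast hn
  set m := ∫ σ, α.mean i n σ ∂P with hm
  set a : ℝ := n * (δ / 2 / 2) with ha
  have ha0 : 0 < a := by positivity
  set D : ℕ → Env E d × (ℕ → Site d) → ℝ :=
    fun k ω => (ω.2 (k * n + n) i : ℝ) - ω.2 (k * n) i - m with hD
  have hDm : ∀ k, Measurable (D k) := fun k =>
    ((measurable_displacement i (k * n) n).comp measurable_snd).sub_const m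
  have hDint : ∀ k, Integrable (D k) (α.jointLaw P) := fun k =>
    (integrable_displacement_jointLaw i (k * n) n).sub (integrable_const m)
  have hsum : ∀ K ω, ∑ k ∈ Finset.range K, D k ω = (ω.2 (K * n) i : ℝ) - ω.2 0 i - K * m := by
    intro K ω
    induction K with
    | zero => simp
    | succ K ih =>
      rw [Finset.sum_range_succ, ih, hD]
      push_cast [add_mul, one_mul]
      ring
  set B : ℝ := R * n + |m| + a + 1 with hB
  have hm0 := abs_nonneg m
  have hRn : (0 : ℝ) ≤ R * n := by positivity
  have hDB : ∀ k, ∀ᵐ ω ∂α.jointLaw P, |D k ω| ≤ B := fun k => by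
    filter_upwards [ae_jointLaw P] with ω hω
    have := abs_sub_le_of_norm1_le hω.2 i (k * n) n
    exact (abs_sub _ _).trans (by linarith)
  let π : ∀ k, Env E d × (ℕ → Site d) → ((j : Finset.Iic (k * n)) → Site d) :=
    fun k ω => Preorder.frestrictLe (π := fun _ => Site d) (k * n) ω.2
  have hπ : ∀ k, Measurable (π k) := fun k =>
    (by fun_prop : Measurable (Preorder.frestrictLe (π := fun _ => Site d) (k * n))).comp
      measurable_snd
  have hcond : ∀ k c, |∫ ω in π k ⁻¹' {c}, D k ω ∂α.jointLaw P| ≤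
      a * (α.jointLaw P).real (π k ⁻¹' {c}) := by
    intro k c
    obtain ⟨x, rfl⟩ := exists_frestrictLe_eq c
    have hpre : π k ⁻¹' {Preorder.frestrictLe (π := fun _ => Site d) (k * n) x} =
        Prod.snd ⁻¹' pathCylinder (k * n) x := by
      rw [pathCylinder_eq_preimage]
      rfl
    rw [hpre]
    exact abs_setIntegral_displacement_sub_le hinv i H (k * n) x
  have hfac : ∀ k, ∃ g : ((j : Finset.Iic (k * n)) → Site d) → ℝ,
      ∀ ω, ∑ j ∈ Finset.range k, D j ω = g (π k ω) := fun k =>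
    ⟨fun h => (h ⟨k * n, by simp⟩ i : ℝ) - h ⟨0, by simp⟩ i - k * m, fun ω => hsum k ω⟩
  have hup := ae_eventually_sum_lt hDm ha0 (by linarith : a ≤ B) (by linarith) hDB hπ hfac
    fun k c => (le_abs_self _).trans (hcond k c)
  have hlow := ae_eventually_sum_lt (D := fun k ω => -D k ω) (fun k => (hDm k).neg) ha0
    (by linarith : a ≤ B) (by linarith) (fun k => by simpa only [abs_neg] using hDB k) hπ
    (fun k => (hfac k).imp' (fun g h => -g h) fun g hg ω => by
      rw [Finset.sum_neg_distrib, hg ω])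
    fun k c => by
      rw [integral_neg]
      exact (neg_le_abs _).trans (hcond k c)
  refine ⟨m / n, ?_⟩
  filter_upwards [hup, hlow, ae_jointLaw P] with ω h1 h2 h3
  have hdiv : Tendsto (fun t : ℕ => t / n) atTop atTop := Nat.tendsto_div_const_atTop (by omega)
  obtain ⟨T, hT⟩ := exists_nat_ge ((R * n + |m|) / (δ / 2))
  rw [div_le_iff₀ (by positivity)] at hT
  filter_upwards [hdiv.eventually h1, hdiv.eventually h2, eventually_ge_atTop T,
    eventually_gt_atTop 0] with t h4 h5 h6 h7
  have ht0 : (0 : ℝ) < t := by exact_mod_cast h7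
  have h6' : (T : ℝ) ≤ t := by exact_mod_cast h6
  rw [hsum, h3.1] at h4
  rw [Finset.sum_neg_distrib, hsum, h3.1] at h5
  simp only [Pi.zero_apply, Int.cast_zero, sub_zero] at h4 h5
  set K := t / n with hK
  set r := t % n with hr
  have htK : K * n + r = t := by
    rw [mul_comm]
    exact Nat.div_add_mod t n
  have htK' : (K : ℝ) * n + r = t := by exact_mod_cast htK
  have hrn : (r : ℝ) ≤ n := by exact_mod_cast (Nat.mod_lt t (by omega)).le
  have h8 := abs_sub_le_of_norm1_le h3.2 i (K * n) r
  rw [htK] at h8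
  have h9 : (R : ℝ) * r ≤ R * n := by gcongr
  have h10 : |(r : ℝ) * (m / n)| ≤ |m| := by
    rw [abs_mul, abs_div, Nat.abs_cast, Nat.abs_cast, ← mul_div_assoc, div_le_iff₀ hn0, mul_comm]
    gcongr
  have h11 : 2 * a * K ≤ δ / 2 * t := by
    rw [ha, ← htK']
    have : 0 ≤ δ / 2 * r := by positivity
    linarith
  have h12 : (t : ℝ) * (m / n) = K * m + r * (m / n) := by
    rw [← htK']
    field_simp
  have h13 : (R * n + |m| : ℝ) ≤ t * (δ / 2) := hT.trans (by gcongr)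
  rw [div_sub' ht0.ne', abs_div, abs_of_pos ht0, div_le_iff₀ ht0, h12, abs_le]
  rw [abs_le] at h8 h10
  constructor <;> linarith [h8.1, h8.2, h10.1, h10.2]

/-- The velocity in a given direction exists. -/
lemma exists_ae_tendsto_div (hinv : TranslationInvariant P) (hmix : α.ConeMixing P)
    (hell : α.EllipticInTime) (i : Fin d) :
    ∃ v : ℝ, ∀ᵐ ω ∂α.jointLaw P, Tendsto (fun t : ℕ => (ω.2 t i : ℝ) / t) atTop (𝓝 v) := by
  choose u hu using fun j : ℕ => exists_ae_eventually_abs_sub_le hinv hmix hell i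
    (Nat.one_div_pos_of_nat (α := ℝ) (n := j))
  have hall := ae_all_iff.2 hu
  have hcauchy : ∀ ω : Env E d × (ℕ → Site d),
      (∀ j : ℕ, ∀ᶠ t : ℕ in atTop, |(ω.2 t i : ℝ) / t - u j| ≤ 1 / ((j : ℝ) + 1)) →
        CauchySeq fun t : ℕ => (ω.2 t i : ℝ) / t := by
    intro ω hω
    rw [Metric.cauchySeq_iff']
    intro ε hε
    obtain ⟨j, hj⟩ := exists_nat_one_div_lt (half_pos hε)
    obtain ⟨N, hN⟩ := eventually_atTop.1 (hω j)
    refine ⟨N, fun t ht => ?_⟩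
    have h1 := abs_le.1 (hN t ht)
    have h2 := abs_le.1 (hN N le_rfl)
    rw [Real.dist_eq, abs_lt]
    constructor <;> linarith [h1.1, h1.2, h2.1, h2.2]
  -- The limit along a typical `ω` is also the limit of `u`, which does not involve `ω`; hence it is
  -- deterministic.
  have hlim : ∀ (ω : Env E d × (ℕ → Site d)) (v : ℝ),
      (∀ j : ℕ, ∀ᶠ t : ℕ in atTop, |(ω.2 t i : ℝ) / t - u j| ≤ 1 / ((j : ℝ) + 1)) →
        Tendsto (fun t : ℕ => (ω.2 t i : ℝ) / t) atTop (𝓝 v) → Tendsto u atTop (𝓝 v) := by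
    intro ω v hω hv
    rw [tendsto_iff_dist_tendsto_zero]
    refine squeeze_zero (fun _ => dist_nonneg) (fun j => ?_) tendsto_one_div_add_atTop_nhds_zero_nat
    rw [Real.dist_eq, abs_sub_comm]
    exact le_of_tendsto (hv.sub_const (u j)).abs (hω j)
  obtain ⟨ω₀, hω₀⟩ := hall.exists
  obtain ⟨v, hv⟩ := cauchySeq_tendsto_of_complete (hcauchy ω₀ hω₀)
  refine ⟨v, ?_⟩
  filter_upwards [hall] with ω hω
  obtain ⟨w, hw⟩ := cauchySeq_tendsto_of_complete (hcauchy ω hω)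
  rwa [tendsto_nhds_unique (hlim ω₀ v hω₀ hv) (hlim ω w hω hw)]

end JumpRule

theorem corollary1p3 {E : Type*} [Finite E] [MeasurableSpace E] [MeasurableSingletonClass E]
    {d R : ℕ} (P : Measure (Env E d)) [IsProbabilityMeasure P] (α : JumpRule E d R)
    (h_inv : TranslationInvariant P) (h_erg : ErgodicInTime P)
    (h_mix : α.ConeMixing P) (h_ell : α.EllipticInTime) :
    ∃ v : Fin d → ℝ, ∀ᵐ ω ∂(α.jointLaw P),
      Tendsto (fun (t : ℕ) (i : Fin d) => (ω.2 t i : ℝ) / (t : ℝ)) atTop (𝓝 v) := by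
  choose v hv using fun i => JumpRule.exists_ae_tendsto_div h_inv h_mix h_ell i
  refine ⟨v, ?_⟩
  filter_upwards [ae_all_iff.2 hv] with ω hω
  exact tendsto_pi_nhds.2 hω
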